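/- Let $\Theta\in\mathbb R^{d\times d}$ have all eigenvalues with strictly positive real part, let $L\in\mathbb R^{d\times n}$ be such that $\Sigma^X:=LL^\top$ is positive definite, let $a\in\mathbb R^d$ and $T>0$. Let $X$ be the mean-reverting (Ornstein--Uhlenbeck) process $$dX(t)=-\Theta X(t)\,dt+L\,dW(t),\qquad X(0)=a,\qquad t\ge 0,$$ with $W$ a standard $n$-dimensional Brownian motion. Let $Y=PX(T)+\varepsilon\in\mathbb R^K$ be a noisy linear view, where $P\in\mathbb R^{K\times d}$ and $\varepsilon\sim\mathcal N(0,\Omega)$ is independent of $X$, with $\Omega$ positive definite. For $y\in\mathbb R^K$ let $B=(B(t))_{t\in[0,T]}$ be the conditional process $B(t)=(X(t)\mid Y=y)$. (Conditional laws given a single value are given by the weakly continuous version of the regular conditional distribution, and processes are identified when they have the same law.) For starting point $a'\in\mathbb R^d$, target $z\in\mathbb R^d$ and hitting times $S\in(0,\infty)^d$, a process on $[0,T]$ is called a multidimensional mean-reverting bridge (m-MrB) from $a'$ to $z$ with hitting times $S$ if it has the law of $(X'(t)\mid X'_1(S_1)=z_1,\dots,X'_d(S_d)=z_d)_{t\in[0,T]}$,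 where $dX'=-\Theta X'\,dt+L\,dW$, $X'(0)=a'$. It is called an m-MrB if it is one for some $a'$, $z$ and $S$. For $\delta\in(0,\infty)^d$ let $F(\delta)\in\mathbb R^{d\times d}$ be the matrix whose $i$-th row is $e_i^\top e^{-\Theta\delta_i}$, let $$C(\delta)_{ij}=\int_0^{\min\{\delta_i,\delta_j\}}e_i^\top e^{-\Theta(\delta_i-u)}\,\Sigma^X\,e^{-\Theta^\top(\delta_j-u)}e_j\,du,$$ and let $\mathcal P(\delta)=F(\delta)^\top C(\delta)^{-1}F(\delta)$ be the precision gain. Then: 1. (Meaning of $\mathcal P$.) For every $\delta\in(0,\infty)^d$, with $X(T\mathbf 1+\delta):=(X_1(T+\delta_1),\dots,X_d(T+\delta_d))$, almost surely $$\mathbb V[X(T)\mid X(T\mathbf 1+\delta)]^{-1}-\mathbb V[X(T)\mid X(0)]^{-1}=\mathcal P(\delta).$$ 2. $B$ is an m-MrB if and only if there is a $\delta\in(0,\infty)^d$ with $P^\top\Omega^{-1}P=\mathcal P(\delta)$. 3. Whenever $\delta\in(0,\infty)^d$ satisfies $P^\top\Omega^{-1}P=\mathcal P(\delta)$, the centered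 process $B(t)-\mathbb E[B(t)]$ is an m-MrB from $0$ to $0$ with hitting times $T\mathbf 1+\delta$. If in addition $P$ has full column rank, then $F(\delta)$ is invertible and $B$ is an m-MrB from $a$ with hitting times $T\mathbf 1+\delta$ to exactly one target, namely $$\tilde y=C(\delta)F(\delta)^{-\top}P^\top\Omega^{-1}y.$$ -/

import Mathlib

open MeasureTheory ProbabilityTheory Matrix
open scoped NNReal BoundedContinuousFunction

universe u v

/-- `X` is an Ornstein-Uhlenbeck (mean-reverting) process started at `a`, i.e. a continuous solution
of `dX(t) = -Θ X(t) dt + L dW(t)`, `X(0) = a`, for some `n`-dimensional standard Brownian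
motion `W`. As the diffusion matrix `L` is constant, the Itô integral `∫₀ᵗ L dW` is `L W(t)` and the
equation is a pathwise integral equation. -/
structure IsOU {Ω : Type*} [MeasurableSpace Ω] {d n : ℕ} (Θ : Matrix (Fin d) (Fin d) ℝ)
    (L : Matrix (Fin d) (Fin n) ℝ) (a : Fin d → ℝ) (X : ℝ≥0 → Ω → Fin d → ℝ) (μ : Measure Ω) :
    Prop where
  measurable : ∀ t, Measurable (X t)
  continuous : ∀ᵐ ω ∂μ, Continuous fun t => X t ω
  sde : ∃ W : Fin n → ℝ≥0 → Ω → ℝ,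
    (∀ j t, Measurable (W j t)) ∧ (∀ j, IsBrownianReal (W j) μ) ∧
    iIndepFun (fun j ω t => W j t ω) μ ∧
    ∀ᵐ ω ∂μ, ∀ t : ℝ≥0,
      X t ω = a - (∫ s in (0 : ℝ)..t, Θ *ᵥ X s.toNNReal ω) + L *ᵥ fun j => W j t ω

/-- `Y` is a noisy linear view of `X(T)`: `Y = P X(T) + ε`, where `ε` has law `N(0, Om)` and is
independent of the process `X`. -/
structure IsNoisyView {Ω : Type*} [MeasurableSpace Ω] {d K : ℕ} (P : Matrix (Fin K) (Fin d) ℝ)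
    (Om : Matrix (Fin K) (Fin K) ℝ) (T : ℝ≥0) (X : ℝ≥0 → Ω → Fin d → ℝ) (Y : Ω → Fin K → ℝ)
    (μ : Measure Ω) : Prop where
  measurable : Measurable Y
  law : HasLaw (fun ω => WithLp.toLp 2 (Y ω - P *ᵥ X T ω)) (multivariateGaussian 0 Om) μ
  indep : IndepFun (fun ω t => X t ω) (fun ω => Y ω - P *ᵥ X T ω) μ

/-- The process `B`, defined under the probability measure `ν`, is a version of `(X | U = u)`, the
process `X` (under `μ`) conditioned on `U = u`: its law is `κ u`, where `κ` is
the regular conditional distribution of `X` given `U` whose finite-dimensional distributions depend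
weakly continuously on the conditioning value. (Regular conditional distributions are only
determined up to null sets; the continuous version is unique on the support of the law of `U`,
which makes conditioning on a single value meaningful.) Laws of processes are measures on the
product space of paths, so they amount to the finite-dimensional distributions. -/
def IsConditionedProcess {Ω Ω' ι E F : Type*} [MeasurableSpace Ω] [MeasurableSpace Ω']
    [MeasurableSpace E] [TopologicalSpace E] [MeasurableSpace F] [TopologicalSpace F]
    (X : ι → Ω → E) (U : Ω → F) (u : F) (μ : Measure Ω) (B : ι → Ω' → E) (ν : Measure Ω') : Prop :=
  ∃ κ : Kernel F (ι → E), IsMarkovKernel κ ∧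
    HasCondDistrib (fun ω t => X t ω) U κ μ ∧
    (∀ (I : Finset ι) (f : (I → E) →ᵇ ℝ),
      ContinuousOn (fun w => ∫ x, f (I.restrict x) ∂(κ w)) (μ.map U).support) ∧
    u ∈ (μ.map U).support ∧
    HasLaw (fun ω t => B t ω) (κ u) ν

/-- `B`, a process on the time interval `[0, T]`, is (the restriction to `[0, T]` of) a
multidimensional mean-reverting bridge from `a` to `y`, with mean-reversion rate `Θ`, diffusion
matrix `L` and hitting times `S`: it is `(X | X₁(S₁) = y₁, …, X_d(S_d) = y_d)` for an
Ornstein-Uhlenbeck process `X` started at `a`. -/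
def IsMMrB {Ω' : Type v} [MeasurableSpace Ω'] {d n : ℕ} (Θ : Matrix (Fin d) (Fin d) ℝ)
    (L : Matrix (Fin d) (Fin n) ℝ) (a y : Fin d → ℝ) (S : Fin d → ℝ≥0) {T : ℝ≥0}
    (B : Set.Iic T → Ω' → Fin d → ℝ) (ν : Measure Ω') : Prop :=
  (∀ i, 0 < S i) ∧
  ∃ (Ω : Type u) (_ : MeasurableSpace Ω) (μ : Measure Ω) (X : ℝ≥0 → Ω → Fin d → ℝ),
    IsProbabilityMeasure μ ∧ IsOU Θ L a X μ ∧
    IsConditionedProcess (fun t : Set.Iic T => X t) (fun ω i => X (S i) ω i) y μ B ν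

/-- The conditional covariance matrix `𝕍[Z | U]`, a random matrix. -/
noncomputable def condCovMatrix {Ω : Type*} [MeasurableSpace Ω] {d m : ℕ} (Z : Ω → Fin d → ℝ)
    (U : Ω → Fin m → ℝ) (μ : Measure Ω) (ω : Ω) : Matrix (Fin d) (Fin d) ℝ :=
  let m := MeasurableSpace.comap U inferInstance
  let R : Fin d → Ω → ℝ := fun i ω' => Z ω' i - (μ[fun ω'' => Z ω'' i | m]) ω'
  Matrix.of fun i j => (μ[fun ω' => R i ω' * R j ω' | m]) ω

/-- The matrix `F(δ)`, whose `i`-th row is `eᵢᵀ exp(-δᵢ Θ)`. -/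
noncomputable def bridgeF {d : ℕ} (Θ : Matrix (Fin d) (Fin d) ℝ) (δ : Fin d → ℝ≥0) :
    Matrix (Fin d) (Fin d) ℝ :=
  Matrix.of fun i j => NormedSpace.exp (-((δ i : ℝ) • Θ)) i j

/-- The matrix `C(δ)`, with entries
`∫ u in 0..min δᵢ δⱼ, eᵢᵀ exp(-(δᵢ - u) Θ) Sig exp(-(δⱼ - u) Θᵀ) eⱼ`. -/
noncomputable def bridgeC {d : ℕ} (Θ Sig : Matrix (Fin d) (Fin d) ℝ) (δ : Fin d → ℝ≥0) :
    Matrix (Fin d) (Fin d) ℝ :=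
  Matrix.of fun i j => ∫ u in (0 : ℝ)..(min (δ i) (δ j) : ℝ≥0),
    (NormedSpace.exp (-(((δ i : ℝ) - u) • Θ)) * Sig *
      NormedSpace.exp (-(((δ j : ℝ) - u) • Θᵀ))) i j

/-- The precision gain `𝒫(δ; Θ, Sig) = F(δ)ᵀ C(δ)⁻¹ F(δ)`. -/
noncomputable def precisionGain {d : ℕ} (Θ Sig : Matrix (Fin d) (Fin d) ℝ) (δ : Fin d → ℝ≥0) :
    Matrix (Fin d) (Fin d) ℝ :=
  (bridgeF Θ δ)ᵀ * (bridgeC Θ Sig δ)⁻¹ * bridgeF Θ δ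

/-! Let a Gaussian vector `F X(T) + N` be observed, with `N` centered, of covariance `S` and
independent of `X` up to time `T`. The value `u` changes the law of `X` on `[0, T]` only through the
precision `Q = Fᵀ S⁻¹ F` and the vector `h = Fᵀ S⁻¹ u`: the conditional law is Gaussian with mean
`bridgeMean` and covariance `bridgeCov` (`IsGaussianView.isConditionedProcess_iff`). Both kinds of
conditioning in the theorem have this form. The noisy view has `F = P`, `S = Ω`. By the Markov
property `X_i(T + δ_i)` is the `i`-th entry of `exp(-δ_i Θ) X(T)` plus noise produced after `T`, so
a bridge with hitting times `T + δ` has `F = F(δ)`, `S = C(δ)` and `Q = 𝒫(δ)`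
(`isGaussianView_bridge`, `isMMrB_iff`).

The law determines `Q`: with `V` the variance of `X(T)`, the conditional variance is `V (1 + Q
V)⁻¹`, whose inverse is `V⁻¹ + Q` (`inv_bridgeCov`). This is the first claim, and it gives necessity
in the second once all hitting times exceed `T`. They must: a coordinate hit at a time `S_i ≤ T`
would be deterministic there, whereas the covariance of `B(s)` and `B(T)` is invertible for `0 < s ≤
T` (`not_deterministic`). Conversely, if the precisions agree, a target `z` with `F(δ)ᵀ C(δ)⁻¹ z =
Pᵀ Ω⁻¹ y` is needed; the right side equals `Pᵀ Ω⁻¹ P x` for some `x` (`exists_mulVec_eq`), and `z =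
F(δ) x` works. Centering sets `h` and the starting point to zero. Full column rank makes `Q`
positive definite, hence `F(δ)` invertible and `z` unique.

Two inputs support this. Variation of constants turns `X(t)` into a Wiener integral, a pathwise
limit of Gaussian sums, which gives its law (`IsOU.isGaussianProcess`). Conditioning on a single
value is unambiguous because the observed vector has full support and the regression kernel is
continuous (`isConditionedProcess_iff`). -/

/-! ### The matrix exponential as a function of time -/

section MatrixExp

variable {d : ℕ}

/-- The matrix `exp (t Θ)`. -/
noncomputable def expM (Θ : Matrix (Fin d) (Fin d) ℝ) (t : ℝ) : Matrix (Fin d) (Fin d) ℝ :=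
  NormedSpace.exp (t • Θ)

section

attribute [local instance] Matrix.linftyOpNormedAlgebra Matrix.linftyOpNormedRing

lemma hasDerivAt_expM (Θ : Matrix (Fin d) (Fin d) ℝ) (t : ℝ) :
    HasDerivAt (expM Θ) (Θ * expM Θ t) t :=
  hasDerivAt_exp_smul_const' Θ t

end

/-- Differentiation is done entrywise from here on, so that no norm on matrices has to be fixed. -/
lemma hasDerivAt_expM_apply (Θ : Matrix (Fin d) (Fin d) ℝ) (i j : Fin d) (t : ℝ) :
    HasDerivAt (fun s => expM Θ s i j) ((Θ * expM Θ t) i j) t :=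
  hasDerivAt_pi.1 (hasDerivAt_pi.1 (hasDerivAt_expM Θ t) i) j

@[fun_prop]
lemma continuous_expM (Θ : Matrix (Fin d) (Fin d) ℝ) : Continuous (expM Θ) :=
  continuous_pi fun i => continuous_pi fun j =>
    continuous_iff_continuousAt.2 fun t => (hasDerivAt_expM_apply Θ i j t).continuousAt

@[simp]
lemma expM_zero (Θ : Matrix (Fin d) (Fin d) ℝ) : expM Θ 0 = 1 := by
  simp [expM]

lemma expM_add (Θ : Matrix (Fin d) (Fin d) ℝ) (s t : ℝ) :
    expM Θ (s + t) = expM Θ s * expM Θ t := by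
  rw [expM, add_smul, Matrix.exp_add_of_commute]
  · rfl
  · exact ((Commute.refl Θ).smul_left s).smul_right t

lemma expM_mul_expM_neg (Θ : Matrix (Fin d) (Fin d) ℝ) (t : ℝ) :
    expM Θ t * expM Θ (-t) = 1 := by
  rw [← expM_add]; simp

lemma isUnit_expM (Θ : Matrix (Fin d) (Fin d) ℝ) (t : ℝ) : IsUnit (expM Θ t) :=
  IsUnit.of_mul_eq_one _ (expM_mul_expM_neg Θ t)

lemma mul_expM_comm (Θ : Matrix (Fin d) (Fin d) ℝ) (t : ℝ) :
    Θ * expM Θ t = expM Θ t * Θ := by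
  exact ((Commute.refl Θ).smul_right t).exp_right

lemma exp_neg_smul_eq_expM (Θ : Matrix (Fin d) (Fin d) ℝ) (t : ℝ) :
    NormedSpace.exp (-(t • Θ)) = expM Θ (-t) := by
  rw [expM, neg_smul]

lemma expM_transpose (Θ : Matrix (Fin d) (Fin d) ℝ) (t : ℝ) : expM Θᵀ t = (expM Θ t)ᵀ := by
  rw [expM, expM, ← Matrix.exp_transpose, transpose_smul]

end MatrixExp

/-! ### The covariance function of the Ornstein-Uhlenbeck process -/

section OUCov

variable {d : ℕ}

/-- The matrix `∫₀ᵗ exp(uΘ) Sig exp(uΘᵀ) du`. -/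
noncomputable def ouGram (Θ Sig : Matrix (Fin d) (Fin d) ℝ) (t : ℝ) : Matrix (Fin d) (Fin d) ℝ :=
  Matrix.of fun i j => ∫ u in (0 : ℝ)..t, (expM Θ u * Sig * (expM Θ u)ᵀ) i j

/-- The covariance matrix of `X(s)` and `X(t)` for an Ornstein-Uhlenbeck process `X` with
deterministic initial value. -/
noncomputable def ouCov (Θ Sig : Matrix (Fin d) (Fin d) ℝ) (s t : ℝ≥0) :
    Matrix (Fin d) (Fin d) ℝ :=
  expM Θ (-s) * ouGram Θ Sig (min s t : ℝ≥0) * (expM Θ (-t))ᵀ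

lemma mul_of_integral_mul {F : ℝ → Matrix (Fin d) (Fin d) ℝ} (hF : Continuous F)
    (A B : Matrix (Fin d) (Fin d) ℝ) (a b : ℝ) :
    A * (Matrix.of fun i j => ∫ u in a..b, F u i j) * B
      = Matrix.of fun i j => ∫ u in a..b, (A * F u * B) i j := by
  ext i j
  simp only [Matrix.mul_apply, Matrix.of_apply, Finset.sum_mul]
  rw [intervalIntegral.integral_finsetSum fun k _ =>
    Continuous.intervalIntegrable (by fun_prop) _ _]
  refine Finset.sum_congr rfl fun k _ => ?_
  rw [intervalIntegral.integral_finsetSum fun l _ =>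
    Continuous.intervalIntegrable (by fun_prop) _ _]
  refine Finset.sum_congr rfl fun l _ => ?_
  rw [intervalIntegral.integral_mul_const, intervalIntegral.integral_const_mul]

variable (Θ Sig : Matrix (Fin d) (Fin d) ℝ)

lemma ouCov_apply (s t : ℝ≥0) (i j : Fin d) :
    ouCov Θ Sig s t i j = ∫ u in (0 : ℝ)..(min s t : ℝ≥0),
      (expM Θ (u - s) * Sig * (expM Θ (u - t))ᵀ) i j := by
  rw [ouCov, ouGram, mul_of_integral_mul (by fun_prop), Matrix.of_apply]
  refine intervalIntegral.integral_congr fun u _ => ?_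
  simp only [sub_eq_neg_add, expM_add, transpose_mul, Matrix.mul_assoc]

/-- This identifies `C(δ)` as the covariance matrix of the coordinates of a process with
deterministic start, the `i`-th one read at time `δ i`. -/
lemma bridgeC_apply (δ : Fin d → ℝ≥0) (i j : Fin d) :
    bridgeC Θ Sig δ i j = ouCov Θ Sig (δ i) (δ j) i j := by
  rw [ouCov_apply, bridgeC, Matrix.of_apply]
  simp only [exp_neg_smul_eq_expM, expM_transpose, neg_sub]

lemma bridgeF_apply (δ : Fin d → ℝ≥0) (i j : Fin d) :
    bridgeF Θ δ i j = expM Θ (-δ i) i j := by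
  rw [bridgeF, Matrix.of_apply, exp_neg_smul_eq_expM]

variable {Θ Sig}

/-- Covariance form of the Markov property: noise arriving after `s ≥ t` is uncorrelated with
`X(t)`, so only the decay factor changes. -/
lemma ouCov_add_left {s t : ℝ≥0} (h : t ≤ s) (r : ℝ≥0) :
    ouCov Θ Sig (s + r) t = expM Θ (-r) * ouCov Θ Sig s t := by
  rw [ouCov, ouCov, min_eq_right h, min_eq_right (h.trans le_self_add), NNReal.coe_add,
    neg_add_rev, expM_add]
  simp only [Matrix.mul_assoc]

lemma ouCov_transpose (hS : Sigᵀ = Sig) (s t : ℝ≥0) :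
    (ouCov Θ Sig s t)ᵀ = ouCov Θ Sig t s := by
  have : (ouGram Θ Sig (min s t : ℝ≥0))ᵀ = ouGram Θ Sig (min s t : ℝ≥0) := by
    ext i j
    simp only [ouGram, Matrix.transpose_apply, Matrix.of_apply]
    refine intervalIntegral.integral_congr fun u _ => ?_
    rw [← Matrix.transpose_apply (expM Θ u * Sig * (expM Θ u)ᵀ) i j]
    simp only [transpose_mul, transpose_transpose, hS, Matrix.mul_assoc]
  rw [ouCov, ouCov, transpose_mul, transpose_mul, transpose_transpose, this, min_comm,
    Matrix.mul_assoc]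

lemma ouCov_eq_mul_transpose (hS : Sigᵀ = Sig) {s t : ℝ≥0} (h : s ≤ t) :
    ouCov Θ Sig s t = ouCov Θ Sig s s * (expM Θ (-(t - s : ℝ≥0)))ᵀ := by
  conv_lhs => rw [← add_tsub_cancel_of_le h]
  rw [← ouCov_transpose hS, ouCov_add_left le_rfl, transpose_mul, ouCov_transpose hS]

/-- The integral is split at `T`: the noise before `T` contributes the transported variance of
`X(T)`, and the noise after `T` is a copy restarted at time zero. -/
lemma ouCov_add_add (T r s : ℝ≥0) :
    ouCov Θ Sig (T + r) (T + s)
      = expM Θ (-r) * ouCov Θ Sig T T * (expM Θ (-s))ᵀ + ouCov Θ Sig r s := by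
  ext i j
  rw [Matrix.add_apply, ouCov_apply Θ Sig r s, ouCov_apply, ouCov, ouGram,
    mul_of_integral_mul (by fun_prop), mul_of_integral_mul (by fun_prop), Matrix.of_apply,
    min_self, ← intervalIntegral.integral_add_adjacent_intervals (b := (T : ℝ))
      (Continuous.intervalIntegrable (by fun_prop) _ _)
      (Continuous.intervalIntegrable (by fun_prop) _ _)]
  congr 1
  · refine intervalIntegral.integral_congr fun u _ => ?_
    have h1 : u - (T + r : ℝ≥0) = -r + (-T + u) := by push_cast; ring
    have h2 : u - (T + s : ℝ≥0) = -s + (-T + u) := by push_cast; ring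
    simp only [h1, h2, expM_add, transpose_mul, Matrix.mul_assoc]
  · rw [← add_min]
    have := intervalIntegral.integral_comp_add_right (a := 0) (b := (min r s : ℝ≥0))
      (fun u => (expM Θ (u - (T + r : ℝ≥0)) * Sig * (expM Θ (u - (T + s : ℝ≥0)))ᵀ) i j) (T : ℝ)
    rw [zero_add, ← NNReal.coe_add, add_comm _ T] at this
    rw [← this]
    refine intervalIntegral.integral_congr fun u _ => ?_
    have h1 : u + T - (T + r : ℝ≥0) = u - r := by push_cast; ring
    have h2 : u + T - (T + s : ℝ≥0) = u - s := by push_cast; ring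
    simp only [h1, h2]

lemma bridgeC_const (t : ℝ≥0) : bridgeC Θ Sig (fun _ => t) = ouCov Θ Sig t t := by
  ext i j; rw [bridgeC_apply]

/-- The integrand in the quadratic form of `bridgeC`. -/
noncomputable def bridgeVec (Θ : Matrix (Fin d) (Fin d) ℝ) (δ : Fin d → ℝ≥0) (x : Fin d → ℝ)
    (u : ℝ) : Fin d → ℝ :=
  ∑ i, Set.indicator (Set.Ioc (0 : ℝ) (δ i)) (fun u => x i • expM Θ (u - δ i) i) u

/-- The indicator of `(0, min (δ i) (δ j)]` is the product of the indicators for `i` and `j`, so the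
double sum factors under one integral over the whole line. -/
lemma dotProduct_bridgeC_mulVec (δ : Fin d → ℝ≥0) (x : Fin d → ℝ) :
    Integrable (fun u => bridgeVec Θ δ x u ⬝ᵥ Sig *ᵥ bridgeVec Θ δ x u) ∧
    x ⬝ᵥ bridgeC Θ Sig δ *ᵥ x = ∫ u, bridgeVec Θ δ x u ⬝ᵥ Sig *ᵥ bridgeVec Θ δ x u := by
  have key : ∀ u, bridgeVec Θ δ x u ⬝ᵥ Sig *ᵥ bridgeVec Θ δ x u = ∑ i, ∑ j,
      Set.indicator (Set.Ioc (0 : ℝ) (min (δ i) (δ j) : ℝ≥0)) (fun u =>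
        x i * ((expM Θ (u - δ i) * Sig * (expM Θ (u - δ j))ᵀ) i j * x j)) u := by
    intro u
    simp only [bridgeVec, Matrix.mulVec_sum, sum_dotProduct, dotProduct_sum]
    rw [Finset.sum_comm]
    refine Finset.sum_congr rfl fun i _ => Finset.sum_congr rfl fun j _ => ?_
    have hI : Set.Ioc (0 : ℝ) (min (δ i) (δ j) : ℝ≥0)
        = Set.Ioc (0 : ℝ) (δ i) ∩ Set.Ioc (0 : ℝ) (δ j) := by
      rw [NNReal.coe_min, Set.Ioc_inter_Ioc, max_self]
    rw [hI]
    by_cases hi : u ∈ Set.Ioc (0 : ℝ) (δ i)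
    · by_cases hj : u ∈ Set.Ioc (0 : ℝ) (δ j)
      · rw [Set.indicator_of_mem hi, Set.indicator_of_mem hj,
          Set.indicator_of_mem (Set.mem_inter hi hj), smul_dotProduct, Matrix.mulVec_smul,
          dotProduct_smul, smul_eq_mul, smul_eq_mul, mul_comm (x j), Matrix.mul_assoc]
        rfl
      · rw [Set.indicator_of_notMem hj, Set.indicator_of_notMem fun h => hj (Set.mem_of_mem_inter_right h)]
        simp
    · rw [Set.indicator_of_notMem hi, Set.indicator_of_notMem fun h => hi (Set.mem_of_mem_inter_left h)]
      simp
  have hint : ∀ i j, Integrable (Set.indicator (Set.Ioc (0 : ℝ) (min (δ i) (δ j) : ℝ≥0))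
      (fun u => x i * ((expM Θ (u - δ i) * Sig * (expM Θ (u - δ j))ᵀ) i j * x j))) := by
    intro i j
    rw [integrable_indicator_iff measurableSet_Ioc]
    exact (Continuous.intervalIntegrable (by fun_prop) _ _).1
  simp only [key]
  refine ⟨integrable_finsetSum _ fun i _ => integrable_finsetSum _ fun j _ => hint i j, ?_⟩
  rw [integral_finsetSum _ fun i _ => integrable_finsetSum _ fun j _ => hint i j]
  simp only [dotProduct, Matrix.mulVec, Finset.mul_sum]
  refine Finset.sum_congr rfl fun i _ => ?_
  rw [integral_finsetSum _ fun j _ => hint i j]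
  refine Finset.sum_congr rfl fun j _ => ?_
  rw [integral_indicator measurableSet_Ioc, bridgeC_apply, ouCov_apply,
    ← intervalIntegral.integral_of_le (NNReal.coe_nonneg _),
    intervalIntegral.integral_const_mul, intervalIntegral.integral_mul_const]

/-- Let `δ m` be the largest time carrying a nonzero coefficient and `r` the next smaller value of
`δ`, or `0`. On `(r, δ m)` only coordinates with `δ i = δ m` contribute, and they share one
invertible exponential, so their combination cannot vanish. -/
lemma exists_bridgeVec_ne_zero {δ : Fin d → ℝ≥0} (hδ : ∀ i, 0 < δ i) {x : Fin d → ℝ}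
    (hx : x ≠ 0) :
    ∃ a b : ℝ, a < b ∧ ∀ u ∈ Set.Ioo a b, bridgeVec Θ δ x u ≠ 0 := by
  classical
  obtain ⟨i₀, hi₀⟩ := Function.ne_iff.1 hx
  obtain ⟨m, hm, hmax⟩ := (Finset.univ.filter fun i => x i ≠ 0).exists_max_image δ
    ⟨i₀, by simpa using hi₀⟩
  simp only [Finset.mem_filter, Finset.mem_univ, true_and] at hm hmax
  let J := insert 0 ((Finset.univ.filter fun i => δ i < δ m).image δ)
  obtain ⟨r, hr, hrmax⟩ := J.exists_max_image id ⟨0, by simp [J]⟩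
  have hrm : r < δ m := by
    simp only [J, Finset.mem_insert, Finset.mem_image, Finset.mem_filter, Finset.mem_univ,
      true_and] at hr
    rcases hr with rfl | ⟨i, hi, rfl⟩
    exacts [hδ m, hi]
  refine ⟨r, δ m, hrm, fun u hu h0 => ?_⟩
  have hu0 : 0 < u := lt_of_le_of_lt r.2 hu.1
  have hg : bridgeVec Θ δ x u
      = (fun i => if δ i = δ m then x i else 0) ᵥ* expM Θ (u - δ m) := by
    ext k
    simp only [bridgeVec, Finset.sum_apply, Matrix.vecMul, dotProduct]
    refine Finset.sum_congr rfl fun i _ => ?_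
    by_cases hxi : x i = 0
    · by_cases hi : u ∈ Set.Ioc (0 : ℝ) (δ i)
      · rw [Set.indicator_of_mem hi]; simp [hxi]
      · rw [Set.indicator_of_notMem hi]; simp [hxi]
    rcases (hmax i hxi).lt_or_eq with hlt | heq
    · have : δ i ≤ r := hrmax (δ i) (Finset.mem_insert_of_mem
        (Finset.mem_image_of_mem δ (by simpa using hlt)))
      rw [Set.indicator_of_notMem, if_neg hlt.ne]
      · simp
      · exact fun h => absurd (h.2.trans (NNReal.coe_le_coe.2 this)) (not_le.2 hu.1)
    · rw [Set.indicator_of_mem (Set.mem_Ioc.2 ⟨hu0, by rw [heq]; exact hu.2.le⟩), if_pos heq, heq]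
      rfl
  rw [hg] at h0
  have h1 := congrArg (fun v => v ᵥ* expM Θ (-(u - δ m))) h0
  simp only [Matrix.vecMul_vecMul, expM_mul_expM_neg, Matrix.vecMul_one, Matrix.zero_vecMul] at h1
  have := congrFun h1 m
  simp only [if_true, Pi.zero_apply] at this
  exact hm this

/-- The quadratic form is the integral of a nonnegative function that is strictly positive on a
nonempty open interval. -/
lemma posDef_bridgeC (hS : Sig.PosDef) {δ : Fin d → ℝ≥0} (hδ : ∀ i, 0 < δ i) :
    (bridgeC Θ Sig δ).PosDef := by
  have hST : Sigᵀ = Sig := by simpa using hS.isHermitian.eq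
  refine Matrix.PosDef.of_dotProduct_mulVec_pos ?_ fun x hx => ?_
  · ext i j
    rw [Matrix.conjTranspose_apply, star_trivial, bridgeC_apply, bridgeC_apply,
      ← ouCov_transpose hST, Matrix.transpose_apply]
  · obtain ⟨hi, he⟩ := dotProduct_bridgeC_mulVec (Θ := Θ) (Sig := Sig) δ x
    rw [star_trivial, he, integral_pos_iff_support_of_nonneg]
    · obtain ⟨a, b, hab, hne⟩ := exists_bridgeVec_ne_zero (Θ := Θ) hδ hx
      refine lt_of_lt_of_le ?_ (measure_mono (s := Set.Ioo a b) fun u hu => ?_)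
      · simpa using hab
      · exact (hS.dotProduct_mulVec_pos (hne u hu)).ne'
    · exact fun u => hS.posSemidef.dotProduct_mulVec_nonneg _
    · exact hi

lemma posDef_ouCov_self (hS : Sig.PosDef) {t : ℝ≥0} (ht : 0 < t) : (ouCov Θ Sig t t).PosDef := by
  rw [← bridgeC_const]
  exact posDef_bridgeC hS fun _ => ht

lemma isUnit_ouCov (hS : Sig.PosDef) {s t : ℝ≥0} (hs : 0 < s) (h : s ≤ t) :
    IsUnit (ouCov Θ Sig s t) := by
  rw [ouCov_eq_mul_transpose (by simpa using hS.isHermitian.eq) h]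
  exact (posDef_ouCov_self hS hs).isUnit.mul
    ((Matrix.isUnit_transpose _).2 (isUnit_expM _ _))

end OUCov

/-! ### Gaussian vectors and Gaussian processes -/

section Gaussian

open Filter Topology WithLp InnerProductSpace
open scoped RealInnerProductSpace

variable {Ω : Type*} [MeasurableSpace Ω] {μ : Measure Ω}

lemma variance_sum_mul {κ : Type*} [Fintype κ] [IsFiniteMeasure μ] {V : κ → Ω → ℝ}
    (hV : ∀ i, MemLp (V i) 2 μ) (x : κ → ℝ) :
    Var[fun ω => ∑ i, x i * V i ω; μ] = x ⬝ᵥ (Matrix.of fun i j => cov[V i, V j; μ]) *ᵥ x := by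
  have h : ∀ i, MemLp (fun ω => x i * V i ω) 2 μ := fun i => (hV i).const_mul (x i)
  rw [← covariance_self (Finset.aemeasurable_fun_sum _ fun i _ => (h i).aestronglyMeasurable.aemeasurable),
    covariance_fun_sum_fun_sum h h]
  simp only [covariance_const_mul_left, covariance_const_mul_right, dotProduct, Matrix.mulVec,
    Matrix.of_apply, Finset.mul_sum]
  exact Finset.sum_congr rfl fun i _ => Finset.sum_congr rfl fun j _ => by ring

lemma posSemidef_covariance {κ : Type*} [Fintype κ] [IsFiniteMeasure μ] {V : κ → Ω → ℝ}
    (hV : ∀ i, MemLp (V i) 2 μ) : (Matrix.of fun i j => cov[V i, V j; μ]).PosSemidef := by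
  refine Matrix.PosSemidef.of_dotProduct_mulVec_nonneg ?_ fun x => ?_
  · ext i j
    simp [Matrix.conjTranspose_apply, covariance_comm]
  · rw [star_trivial, ← variance_sum_mul hV]
    exact variance_nonneg _ _

/-- The law of a Gaussian vector is determined by its means and its covariances. -/
lemma HasGaussianLaw.map_toLp_eq {κ : Type*} [Fintype κ] [DecidableEq κ] {V : κ → Ω → ℝ}
    (hV : HasGaussianLaw (fun ω i => V i ω) μ) :
    μ.map (fun ω => toLp 2 fun i => V i ω) = multivariateGaussian (toLp 2 fun i => ∫ ω, V i ω ∂μ)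
      (Matrix.of fun i j => cov[V i, V j; μ]) := by
  have := hV.isProbabilityMeasure
  have hL : ∀ i, MemLp (V i) 2 μ := fun i => (hV.eval i).memLp_two
  have hG := hV.toLp_pi 2
  have := hG.isGaussian_map
  refine Measure.ext_of_charFun (funext fun x => ?_)
  rw [hG.charFun_map_eq, charFun_multivariateGaussian (posSemidef_covariance hL)]
  have h1 : ∀ ω, ⟪x, toLp 2 fun i => V i ω⟫ = ∑ i, x i * V i ω := fun ω => by
    simp [PiLp.inner_apply, mul_comm]
  simp only [h1]
  rw [variance_sum_mul hL, integral_finsetSum _ fun i _ =>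
    ((hL i).integrable one_le_two).const_mul (x i)]
  congr 3
  simp [PiLp.inner_apply, integral_mul_const, mul_comm]

lemma hasGaussianLaw_of_map_toLp_eq {κ : Type*} [Fintype κ] [DecidableEq κ] {V : κ → Ω → ℝ}
    (hm : AEMeasurable (fun ω i => V i ω) μ) {m : κ → ℝ} {S : Matrix κ κ ℝ} (hS : S.PosSemidef)
    (h : μ.map (fun ω => toLp 2 fun i => V i ω) = multivariateGaussian (toLp 2 m) S) :
    HasGaussianLaw (fun ω i => V i ω) μ ∧ (∀ i, ∫ ω, V i ω ∂μ = m i) ∧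
      ∀ i j, cov[V i, V j; μ] = S i j := by
  have hlaw : HasLaw (fun ω => toLp 2 fun i => V i ω) (multivariateGaussian (toLp 2 m) S) μ :=
    ⟨(by fun_prop : Measurable (toLp 2 : (κ → ℝ) → _)).comp_aemeasurable hm, h⟩
  have hV : HasGaussianLaw (fun ω i => V i ω) μ :=
    hlaw.hasGaussianLaw.map_equiv (PiLp.continuousLinearEquiv 2 ℝ _)
  refine ⟨hV, fun i => ?_, fun i j => ?_⟩
  · have h1 := hlaw.hasGaussianLaw.integrable
    have h2 : (∫ ω, (toLp 2 fun i => V i ω : EuclideanSpace ℝ κ) ∂μ) = toLp 2 m := by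
      rw [hlaw.integral_eq]; simp
    have h3 := (EuclideanSpace.proj (𝕜 := ℝ) i).integral_comp_comm h1
    rw [h2] at h3
    simpa using h3
  · have := hlaw.covariance_fun_comp (f := fun x => x i) (g := fun x => x j)
      (Measurable.aemeasurable (by fun_prop)) (Measurable.aemeasurable (by fun_prop))
    rw [covariance_eval_multivariateGaussian hS] at this
    exact this

/-- Characteristic functions converge by dominated convergence, and a centered Gaussian one is a
continuous function of the quadratic form of the covariance. -/
lemma map_toLp_eq_of_tendsto {κ : Type*} [Fintype κ] [DecidableEq κ] [IsProbabilityMeasure μ]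
    {G : ℕ → κ → Ω → ℝ} {H : κ → Ω → ℝ} {S : Matrix κ κ ℝ}
    (hG : ∀ N, HasGaussianLaw (fun ω i => G N i ω) μ) (hH : ∀ i, AEMeasurable (H i) μ)
    (hm : ∀ N i, ∫ ω, G N i ω ∂μ = 0) (hS : S.PosSemidef)
    (hq : ∀ x : κ → ℝ, Tendsto (fun N => x ⬝ᵥ (Matrix.of fun i j => cov[G N i, G N j; μ]) *ᵥ x)
      atTop (𝓝 (x ⬝ᵥ S *ᵥ x)))
    (hlim : ∀ i, ∀ᵐ ω ∂μ, Tendsto (fun N => G N i ω) atTop (𝓝 (H i ω))) :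
    μ.map (fun ω => toLp 2 fun i => H i ω) = multivariateGaussian (toLp 2 0) S := by
  have htoLp : Measurable (toLp 2 : (κ → ℝ) → EuclideanSpace ℝ κ) := by fun_prop
  have hL : ∀ N i, MemLp (G N i) 2 μ := fun N i => ((hG N).eval i).memLp_two
  have hmL : AEMeasurable (fun ω => (toLp 2 fun i => H i ω : EuclideanSpace ℝ κ)) μ :=
    htoLp.comp_aemeasurable (aemeasurable_pi_lambda _ hH)
  have hmN : ∀ N, AEMeasurable (fun ω => (toLp 2 fun i => G N i ω : EuclideanSpace ℝ κ)) μ :=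
    fun N => htoLp.comp_aemeasurable (hG N).aemeasurable
  have := Measure.isProbabilityMeasure_map hmL
  refine Measure.ext_of_charFun (funext fun x => ?_)
  rw [charFun_multivariateGaussian hS]
  have hcont : Continuous fun v : EuclideanSpace ℝ κ => Complex.exp (⟪v, x⟫ * Complex.I) := by
    fun_prop
  have h1 : Tendsto (fun N => charFun (μ.map fun ω =>
      (toLp 2 fun i => G N i ω : EuclideanSpace ℝ κ)) x) atTop
      (𝓝 (charFun (μ.map fun ω => (toLp 2 fun i => H i ω : EuclideanSpace ℝ κ)) x)) := by
    simp only [charFun_apply]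
    rw [integral_map hmL hcont.aestronglyMeasurable]
    have : ∀ N, ∫ v, Complex.exp (⟪v, x⟫ * Complex.I) ∂(μ.map fun ω =>
        (toLp 2 fun i => G N i ω : EuclideanSpace ℝ κ))
        = ∫ ω, Complex.exp (⟪(toLp 2 fun i => G N i ω : EuclideanSpace ℝ κ), x⟫
          * Complex.I) ∂μ := fun N => integral_map (hmN N) hcont.aestronglyMeasurable
    simp only [this]
    refine tendsto_integral_of_dominated_convergence (fun _ => 1)
      (fun N => (hcont.measurable.comp_aemeasurable (hmN N)).aestronglyMeasurable)
      (integrable_const _) (fun N => ae_of_all _ fun ω => ?_) ?_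
    · rw [Complex.norm_exp_ofReal_mul_I]
    · filter_upwards [ae_all_iff.2 hlim] with ω hω
      exact (hcont.tendsto _).comp (((PiLp.continuous_toLp 2 _).tendsto _).comp
        (tendsto_pi_nhds.2 hω))
  refine tendsto_nhds_unique h1 ?_
  have h2 : ∀ N, charFun (μ.map fun ω => (toLp 2 fun i => G N i ω : EuclideanSpace ℝ κ)) x
      = Complex.exp (⟪x, toLp 2 0⟫ * Complex.I
        - (x ⬝ᵥ (Matrix.of fun i j => cov[G N i, G N j; μ]) *ᵥ x : ℝ) / 2) := by
    intro N
    rw [HasGaussianLaw.map_toLp_eq (hG N),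
      charFun_multivariateGaussian (posSemidef_covariance (hL N))]
    simp only [hm]
    rfl
  simp only [h2]
  have hcont' : Continuous fun r : ℝ => Complex.exp
      (⟪x, toLp 2 0⟫ * Complex.I - (r : ℂ) / 2) := by fun_prop
  exact (hcont'.tendsto _).comp (hq x)

/-- A pointwise limit of centered Gaussian processes with converging covariances is Gaussian. -/
lemma isGaussianProcess_of_tendsto {ι : Type*} [IsProbabilityMeasure μ] {G : ℕ → ι → Ω → ℝ}
    {H : ι → Ω → ℝ} {c : ι → ι → ℝ} (hG : ∀ N, IsGaussianProcess (G N) μ)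
    (hm : ∀ N i, ∫ ω, G N i ω ∂μ = 0)
    (hc : ∀ i j, Tendsto (fun N => cov[G N i, G N j; μ]) atTop (𝓝 (c i j)))
    (hlim : ∀ i, ∀ᵐ ω ∂μ, Tendsto (fun N => G N i ω) atTop (𝓝 (H i ω))) :
    IsGaussianProcess H μ ∧ (∀ i, ∫ ω, H i ω ∂μ = 0) ∧ ∀ i j, cov[H i, H j; μ] = c i j := by
  classical
  have hmeas : ∀ i, AEMeasurable (H i) μ := fun i =>
    aemeasurable_of_tendsto_metrizable_ae atTop (fun N => (hG N).aemeasurable i) (hlim i)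
  have hL : ∀ N i, MemLp (G N i) 2 μ := fun N i => ((hG N).hasGaussianLaw_eval i).memLp_two
  have key : ∀ I : Finset ι, HasGaussianLaw (fun ω (i : I) => H i ω) μ ∧
      (∀ i : I, ∫ ω, H i ω ∂μ = 0) ∧ ∀ i j : I, cov[H i, H j; μ] = c i j := by
    intro I
    have hq : ∀ x : I → ℝ, Tendsto
        (fun N => x ⬝ᵥ (Matrix.of fun i j : I => cov[G N i, G N j; μ]) *ᵥ x) atTop
        (𝓝 (x ⬝ᵥ (Matrix.of fun i j : I => c i j) *ᵥ x)) := by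
      intro x
      simp only [dotProduct, Matrix.mulVec, Matrix.of_apply]
      refine tendsto_finsetSum _ fun i _ => Tendsto.const_mul _ ?_
      exact tendsto_finsetSum _ fun j _ => Tendsto.mul_const _ (hc i j)
    have hS : (Matrix.of fun i j : I => c i j).PosSemidef := by
      refine Matrix.PosSemidef.of_dotProduct_mulVec_nonneg ?_ fun x => ?_
      · ext i j
        simp only [Matrix.conjTranspose_apply, Matrix.of_apply, star_trivial]
        exact tendsto_nhds_unique (hc j i) ((hc i j).congr fun N => covariance_comm _ _)
      · rw [star_trivial]
        -- The quadratic form is a limit of variances.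
        refine ge_of_tendsto' (hq x) fun N => ?_
        rw [← variance_sum_mul fun i : I => hL N i]
        exact variance_nonneg _ _
    refine hasGaussianLaw_of_map_toLp_eq (aemeasurable_pi_lambda _ fun i : I => hmeas i)
      (m := 0) hS ?_
    refine map_toLp_eq_of_tendsto (G := fun N (i : I) ω => G N i ω) (fun N => (hG N).hasGaussianLaw I)
      (fun i => hmeas i) (fun N i => hm N i) hS hq fun i => hlim i
  refine ⟨⟨fun I => (key I).1⟩, fun i => (key {i}).2.1 ⟨i, by simp⟩, fun i j =>
    (key {i, j}).2.2 ⟨i, by simp⟩ ⟨j, by simp⟩⟩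

/-- Linear combinations of the values of a Gaussian process form a Gaussian process. -/
lemma IsGaussianProcess.of_mem_span {ι κ : Type*} {G : ι → Ω → ℝ} (hG : IsGaussianProcess G μ)
    {H : κ → Ω → ℝ} (h : ∀ k, H k ∈ Submodule.span ℝ (Set.range G)) : IsGaussianProcess H μ := by
  refine hG.of_isGaussianProcess fun k => ?_
  obtain ⟨c, hc⟩ := (Finsupp.mem_span_range_iff_exists_finsupp).1 (h k)
  refine ⟨c.support, ∑ i : c.support, c i • ContinuousLinearMap.proj i, fun ω => ?_⟩
  rw [← hc, Finsupp.sum, ← Finset.sum_coe_sort]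
  simp [Finset.sum_apply]

lemma IsGaussianProcess.add_const {ι : Type*} {G : ι → Ω → ℝ} (hG : IsGaussianProcess G μ)
    (m : ι → ℝ) : IsGaussianProcess (fun i ω => G i ω + m i) μ where
  hasGaussianLaw I := by
    have h := (hG.hasGaussianLaw I)
    have := h.isGaussian_map
    have h2 : (fun ω => I.restrict fun i => G i ω + m i)
        = (fun v => v + I.restrict m) ∘ fun ω => I.restrict (G · ω) := by
      ext ω i; simp
    constructor
    rw [h2, ← AEMeasurable.map_map_of_aemeasurable (by fun_prop) h.aemeasurable]
    infer_instance

lemma isGaussianProcess_sumElim {ι κ : Type*} {G : ι → Ω → ℝ} {H : κ → Ω → ℝ}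
    (hG : IsGaussianProcess G μ) (hH : IsGaussianProcess H μ)
    (h : IndepFun (fun ω i => G i ω) (fun ω k => H k ω) μ) :
    IsGaussianProcess (Sum.elim G H) μ where
  hasGaussianLaw I := by
    have h1 : IndepFun (fun ω => I.toLeft.restrict (G · ω)) (fun ω => I.toRight.restrict (H · ω)) μ :=
      h.comp (Finset.measurable_restrict _) (Finset.measurable_restrict _)
    have h2 := h1.hasGaussianLaw (hG.hasGaussianLaw _) (hH.hasGaussianLaw _)
    let L : ((I.toLeft → ℝ) × (I.toRight → ℝ)) →L[ℝ] (I → ℝ) :=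
      ContinuousLinearMap.pi fun i => match i with
        | ⟨.inl a, ha⟩ => (ContinuousLinearMap.proj ⟨a, by simpa using ha⟩).comp
            (ContinuousLinearMap.fst ℝ _ _)
        | ⟨.inr a, ha⟩ => (ContinuousLinearMap.proj ⟨a, by simpa using ha⟩).comp
            (ContinuousLinearMap.snd ℝ _ _)
    have h3 : (fun ω => I.restrict (Sum.elim G H · ω))
        = fun ω => L (I.toLeft.restrict (G · ω), I.toRight.restrict (H · ω)) := by
      funext ω i
      rcases i with ⟨i | i, hi⟩ <;> rfl
    rw [h3]
    exact h2.map_fun L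

/-- A finite index set is enlarged to a rectangle `κ × J`, on which the independent Gaussian blocks
are jointly Gaussian; the original vector is a projection. -/
lemma isGaussianProcess_prod_of_iIndepFun {ι κ : Type*} [Finite κ] {G : κ → ι → Ω → ℝ}
    (hG : ∀ k, IsGaussianProcess (G k) μ) (h : iIndepFun (fun k ω i => G k i ω) μ) :
    IsGaussianProcess (fun (p : κ × ι) ω => G p.1 p.2 ω) μ where
  hasGaussianLaw I := by
    classical
    let J := I.image Prod.snd
    have := Fintype.ofFinite κ
    have h1 : iIndepFun (fun k ω => J.restrict (G k · ω)) μ :=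
      h.comp (fun _ => J.restrict) (fun _ => Finset.measurable_restrict _)
    have h2 := h1.hasGaussianLaw fun k => (hG k).hasGaussianLaw J
    let L : (κ → J → ℝ) →L[ℝ] (I → ℝ) := ContinuousLinearMap.pi fun i =>
      (ContinuousLinearMap.proj (R := ℝ) (φ := fun _ : J => ℝ)
        ⟨i.1.2, Finset.mem_image_of_mem _ i.2⟩).comp (ContinuousLinearMap.proj i.1.1)
    exact h2.map_fun L

lemma map_ofLp_map_toLp {κ : Type*} [Fintype κ] {V : Ω → κ → ℝ} (hV : AEMeasurable V μ) :
    (μ.map (fun ω => toLp 2 (V ω))).map (ofLp : EuclideanSpace ℝ κ → _) = μ.map V := by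
  exact AEMeasurable.map_map_of_aemeasurable
    (by fun_prop : Measurable (ofLp : EuclideanSpace ℝ κ → _)).aemeasurable
    ((by fun_prop : Measurable (toLp 2 : (κ → ℝ) → EuclideanSpace ℝ κ)).comp_aemeasurable hV)

/-- Gaussian processes with equal means and covariances have the same law. -/
lemma IsGaussianProcess.map_eq {Ω' : Type*} [MeasurableSpace Ω'] {ν : Measure Ω'} {ι : Type*}
    {G : ι → Ω → ℝ} {H : ι → Ω' → ℝ} (hG : IsGaussianProcess G μ) (hH : IsGaussianProcess H ν)
    (hGm : AEMeasurable (fun ω i => G i ω) μ) (hHm : AEMeasurable (fun ω i => H i ω) ν)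
    (hm : ∀ i, ∫ ω, G i ω ∂μ = ∫ ω, H i ω ∂ν)
    (hc : ∀ i j, cov[G i, G j; μ] = cov[H i, H j; ν]) :
    μ.map (fun ω i => G i ω) = ν.map (fun ω i => H i ω) := by
  classical
  have := hG.isProbabilityMeasure
  have := hH.isProbabilityMeasure
  have hI := Measure.isProbabilityMeasure_map hHm
  refine IsProjectiveLimit.unique (P := fun I : Finset ι =>
    (ν.map (fun ω i => H i ω)).map I.restrict) (fun I => ?_) (fun I => rfl)
  simp only
  rw [AEMeasurable.map_map_of_aemeasurable (Finset.measurable_restrict _).aemeasurable hGm,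
    AEMeasurable.map_map_of_aemeasurable (Finset.measurable_restrict _).aemeasurable hHm]
  have h1 := HasGaussianLaw.map_toLp_eq (V := fun (i : I) ω => G i ω) (hG.hasGaussianLaw I)
  have h2 := HasGaussianLaw.map_toLp_eq (V := fun (i : I) ω => H i ω) (hH.hasGaussianLaw I)
  simp only [hm, hc] at h1
  rw [← h2] at h1
  exact (map_ofLp_map_toLp (hG.hasGaussianLaw I).aemeasurable).symm.trans
    ((congrArg (Measure.map ofLp) h1).trans
      (map_ofLp_map_toLp (hH.hasGaussianLaw I).aemeasurable))

open scoped MatrixOrder in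
/-- A nondegenerate Gaussian vector has full support. -/
lemma HasGaussianLaw.isOpenPosMeasure_map {κ : Type*} [Fintype κ] [DecidableEq κ] {V : κ → Ω → ℝ}
    (hV : HasGaussianLaw (fun ω i => V i ω) μ)
    (hS : (Matrix.of fun i j => cov[V i, V j; μ]).PosDef) :
    (μ.map fun ω i => V i ω).IsOpenPosMeasure := by
  have h := HasGaussianLaw.map_toLp_eq hV
  have hstd : (stdGaussian (EuclideanSpace ℝ κ)).IsOpenPosMeasure := by
    rw [← map_pi_eq_stdGaussian]
    have : (gaussianReal 0 1).IsOpenPosMeasure :=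
      (gaussianReal_absolutelyContinuous' 0 one_ne_zero).isOpenPosMeasure
    exact (PiLp.continuous_toLp 2 _).isOpenPosMeasure_map (WithLp.toLp_surjective 2)
  set S := Matrix.of fun i j => cov[V i, V j; μ]
  -- The law is the image of the standard Gaussian under an affine map, which is onto because the
  -- square root of `S` is invertible.
  have hmv : (multivariateGaussian (toLp 2 fun i => ∫ ω, V i ω ∂μ) S).IsOpenPosMeasure := by
    refine Continuous.isOpenPosMeasure_map (by fun_prop) fun v => ?_
    have hu : IsUnit (CFC.sqrt S) := by
      have h1 : IsUnit (CFC.sqrt S * CFC.sqrt S) := by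
        rw [CFC.sqrt_mul_sqrt_self _ hS.posSemidef.nonneg]; exact hS.isUnit
      exact isUnit_of_mul_isUnit_left h1
    obtain ⟨R, hR⟩ := hu.exists_right_inv
    refine ⟨toEuclideanCLM (𝕜 := ℝ) R (v - toLp 2 fun i => ∫ ω, V i ω ∂μ), ?_⟩
    simp only
    rw [← mul_apply_eq_comp, ← map_mul, hR, map_one]
    simp
  rw [← h] at hmv
  rw [← map_ofLp_map_toLp hV.aemeasurable]
  exact (PiLp.continuous_ofLp 2 _).isOpenPosMeasure_map (WithLp.ofLp_surjective 2)

end Gaussian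

/-! ### Wiener integrals of continuously differentiable functions -/

section Wiener

open Filter Topology

/-- The point `k / (N + 1)` of the grid with mesh `1 / (N + 1)`, stopped at `t`. -/
noncomputable def gridPt (N : ℕ) (t : ℝ≥0) (k : ℕ) : ℝ≥0 := min (k / (N + 1)) t

lemma gridPt_zero (N : ℕ) (t : ℝ≥0) : gridPt N t 0 = 0 := by simp [gridPt]

lemma gridPt_mono (N : ℕ) (t : ℝ≥0) : Monotone (gridPt N t) := fun k l h => by
  unfold gridPt; gcongr

lemma gridPt_le (N : ℕ) (t : ℝ≥0) (k : ℕ) : gridPt N t k ≤ t := min_le_right _ _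

lemma gridPt_succ_le (N : ℕ) (t : ℝ≥0) (k : ℕ) :
    (gridPt N t (k + 1) : ℝ) ≤ gridPt N t k + 1 / (N + 1) := by
  have h : (((k + 1 : ℕ) : ℝ)) / (N + 1) = (k : ℝ) / (N + 1) + 1 / (N + 1) := by
    push_cast; ring
  have h2 : (0 : ℝ) ≤ 1 / (N + 1) := by positivity
  simp only [gridPt, NNReal.coe_min, NNReal.coe_div, NNReal.coe_add, NNReal.coe_natCast,
    NNReal.coe_one, h]
  rcases le_total ((k : ℝ) / (N + 1)) t with h1 | h1
  · rw [min_eq_left h1]; exact min_le_left _ _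
  · rw [min_eq_right h1]; exact (min_le_right _ _).trans (by linarith)

/-- The square in `(N + 1) * (N + 1)` is there because that many steps of length `1 / (N + 1)` reach
`N + 1`, beyond any fixed `t` for large `N`. Cells past `t` are degenerate and contribute nothing to
the sums. -/
lemma gridPt_last {N : ℕ} {t : ℝ≥0} (h : t ≤ N) : gridPt N t ((N + 1) * (N + 1)) = t := by
  refine min_eq_right (h.trans ?_)
  push_cast
  rw [mul_div_cancel_right₀ _ (by positivity)]
  exact le_self_add

/-- Riemann-Stieltjes sums converge to the integral. -/
lemma tendsto_riemannStieltjes {h F F' : ℝ → ℝ} (hh : Continuous h) (hF' : Continuous F')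
    (hF : ∀ x, HasDerivAt F (F' x) x) (t : ℝ≥0) {ξ : ℕ → ℕ → ℝ}
    (hξ : ∀ N k, ξ N k ∈ Set.Icc (gridPt N t k : ℝ) (gridPt N t (k + 1))) :
    Tendsto (fun N => ∑ k ∈ Finset.range ((N + 1) * (N + 1)),
      h (ξ N k) * (F (gridPt N t (k + 1)) - F (gridPt N t k))) atTop
      (𝓝 (∫ r in (0 : ℝ)..t, h r * F' r)) := by
  -- `A` is the total variation of `F` on `[0, t]`. An oscillation of `h` below `ε / (A + 1)` on
  -- each cell gives a total error below `ε`; the `+ 1` covers `A = 0`.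
  set A := ∫ r in (0 : ℝ)..t, |F' r| with hA
  have hA0 : 0 ≤ A := intervalIntegral.integral_nonneg t.2 fun _ _ => abs_nonneg _
  rw [Metric.tendsto_atTop]
  intro ε hε
  obtain ⟨δ, hδ, hu⟩ := Metric.uniformContinuousOn_iff.1
    ((isCompact_Icc (a := (0 : ℝ)) (b := t)).uniformContinuousOn_of_continuous hh.continuousOn)
    (ε / (A + 1)) (by positivity)
  obtain ⟨N₀, hN₀⟩ := exists_nat_one_div_lt hδ
  obtain ⟨N₁, hN₁⟩ := exists_nat_ge t
  refine ⟨max N₀ N₁, fun N hN => ?_⟩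
  have hNt : t ≤ N := hN₁.trans (by exact_mod_cast (le_max_right _ _).trans hN)
  have hmesh : 1 / ((N : ℝ) + 1) < δ := by
    refine lt_of_le_of_lt ?_ hN₀
    have : (N₀ : ℝ) ≤ N := by exact_mod_cast (le_max_left _ _).trans hN
    gcongr
  have hle : ∀ k, (gridPt N t k : ℝ) ≤ gridPt N t (k + 1) := fun k =>
    gridPt_mono N t k.le_succ
  have hhF : Continuous fun r => h r * F' r := hh.mul hF'
  have hsplit : ∀ g : ℝ → ℝ, Continuous g → ∫ r in (0 : ℝ)..t, g r
      = ∑ k ∈ Finset.range ((N + 1) * (N + 1)),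
        ∫ r in (gridPt N t k : ℝ)..gridPt N t (k + 1), g r := by
    intro g hg
    rw [intervalIntegral.sum_integral_adjacent_intervals fun k _ => hg.intervalIntegrable _ _,
      gridPt_zero, gridPt_last hNt, NNReal.coe_zero]
  have hterm : ∀ k, h (ξ N k) * (F (gridPt N t (k + 1)) - F (gridPt N t k))
      - ∫ r in (gridPt N t k : ℝ)..gridPt N t (k + 1), h r * F' r
      = ∫ r in (gridPt N t k : ℝ)..gridPt N t (k + 1), (h (ξ N k) - h r) * F' r := by
    intro k
    rw [← intervalIntegral.integral_eq_sub_of_hasDerivAt (fun x _ => hF x)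
      (hF'.intervalIntegrable _ _), ← intervalIntegral.integral_const_mul,
      ← intervalIntegral.integral_sub (Continuous.intervalIntegrable (by fun_prop) _ _)
        (hhF.intervalIntegrable _ _)]
    simp only [sub_mul]
  rw [Real.dist_eq, hsplit _ hhF, ← Finset.sum_sub_distrib]
  simp only [hterm]
  calc |∑ k ∈ Finset.range ((N + 1) * (N + 1)),
        ∫ r in (gridPt N t k : ℝ)..gridPt N t (k + 1), (h (ξ N k) - h r) * F' r|
      ≤ ∑ k ∈ Finset.range ((N + 1) * (N + 1)),
        ∫ r in (gridPt N t k : ℝ)..gridPt N t (k + 1), ε / (A + 1) * |F' r| := by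
        refine (Finset.abs_sum_le_sum_abs _ _).trans (Finset.sum_le_sum fun k _ => ?_)
        rw [← Real.norm_eq_abs]
        refine intervalIntegral.norm_integral_le_of_norm_le (hle k) (ae_of_all _ fun r hr => ?_)
          ((hF'.abs.const_mul _).intervalIntegrable _ _)
        rw [norm_mul, Real.norm_eq_abs, Real.norm_eq_abs]
        gcongr
        have hb := gridPt_succ_le N t k
        have ht : (gridPt N t (k + 1) : ℝ) ≤ t := gridPt_le N t (k + 1)
        have h0 : (0 : ℝ) ≤ gridPt N t k := NNReal.coe_nonneg _
        have hx := hξ N k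
        refine (hu (ξ N k) ⟨h0.trans hx.1, hx.2.trans ht⟩ r
          ⟨h0.trans hr.1.le, hr.2.trans ht⟩ ?_).le
        rw [Real.dist_eq, abs_sub_lt_iff]
        constructor <;> linarith [hx.1, hx.2, hr.1, hr.2]
    _ = ε / (A + 1) * A := by
        rw [← hsplit _ (hF'.abs.const_mul _), intervalIntegral.integral_const_mul]
    _ < ε := by
        rw [div_mul_eq_mul_div, div_lt_iff₀ (by positivity)]
        nlinarith

variable {Ω : Type*} [MeasurableSpace Ω] {μ : Measure Ω}

/-- The elementary Wiener integral of `f` over `[0, t]` on a grid. -/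
noncomputable def wienerSum (N : ℕ) (f : ℝ → ℝ) (t : ℝ≥0) (w : ℝ≥0 → ℝ) : ℝ :=
  ∑ k ∈ Finset.range ((N + 1) * (N + 1)),
    f (gridPt N t k) * (w (gridPt N t (k + 1)) - w (gridPt N t k))

/-- The Wiener integral of a differentiable function, defined by integration by parts. -/
noncomputable def wienerInt (f f' : ℝ → ℝ) (t : ℝ≥0) (w : ℝ≥0 → ℝ) : ℝ :=
  f t * w t - ∫ r in (0 : ℝ)..t, w r.toNNReal * f' r

/-- Summation by parts: with `f` at left endpoints against increments of `w`, the remaining sum has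
`w` at right endpoints against increments of `f`, and that one converges pathwise because `f` is
continuously differentiable. -/
lemma tendsto_wienerSum {f f' : ℝ → ℝ} (hf' : Continuous f') (hf : ∀ x, HasDerivAt f (f' x) x)
    (t : ℝ≥0) {w : ℝ≥0 → ℝ} (hw : Continuous w) (hw0 : w 0 = 0) :
    Tendsto (fun N => wienerSum N f t w) atTop (𝓝 (wienerInt f f' t w)) := by
  have h1 := tendsto_riemannStieltjes (h := fun r => w r.toNNReal)
    (hw.comp continuous_real_toNNReal) hf' hf t
    (ξ := fun N k => gridPt N t (k + 1))
    (fun N k => ⟨gridPt_mono N t k.le_succ, le_rfl⟩)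
  refine (h1.const_sub (f t * w t)).congr' ?_
  obtain ⟨N₁, hN₁⟩ := exists_nat_ge t
  filter_upwards [eventually_ge_atTop N₁] with N hN
  have hNt : t ≤ N := hN₁.trans (by exact_mod_cast hN)
  have h2 := Finset.sum_range_sub (fun k => f (gridPt N t k) * w (gridPt N t k))
    ((N + 1) * (N + 1))
  rw [gridPt_last hNt, gridPt_zero, hw0, mul_zero, sub_zero] at h2
  rw [← h2, ← Finset.sum_sub_distrib, wienerSum]
  refine Finset.sum_congr rfl fun k _ => ?_
  simp only [Real.toNNReal_coe]
  ring

lemma covariance_increments {w : ℝ≥0 → Ω → ℝ} (hw : IsPreBrownianReal w μ) (a b c e : ℝ≥0) :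
    cov[fun ω => w b ω - w a ω, fun ω => w e ω - w c ω; μ]
      = ((min b e : ℝ≥0) : ℝ) - (min b c : ℝ≥0) - (min a e : ℝ≥0) + (min a c : ℝ≥0) := by
  have := hw.isGaussianProcess.isProbabilityMeasure
  have hL : ∀ t, MemLp (w t) 2 μ := fun t => (hw.isGaussianProcess.hasGaussianLaw_eval t).memLp_two
  rw [covariance_fun_sub_fun_sub (hL _) (hL _) (hL _) (hL _)]
  simp only [hw.covariance_fun_eval, NNReal.coe_min]

/-- Both times use the same grid, so different cells are disjoint and uncorrelated, while equal
cells overlap in the cell stopped at `min s t`. -/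
lemma covariance_grid_increments {w : ℝ≥0 → Ω → ℝ} (hw : IsPreBrownianReal w μ) (N : ℕ)
    (s t : ℝ≥0) (k l : ℕ) :
    cov[fun ω => w (gridPt N s (k + 1)) ω - w (gridPt N s k) ω,
      fun ω => w (gridPt N t (l + 1)) ω - w (gridPt N t l) ω; μ]
      = if k = l then (gridPt N (min s t) (k + 1) : ℝ) - gridPt N (min s t) k else 0 := by
  have hmin : ∀ {s t : ℝ≥0} {i j : ℕ}, i ≤ j →
      min (gridPt N s i) (gridPt N t j) = gridPt N (min s t) i := by
    intro s t i j hij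
    have : (i / (N + 1) : ℝ≥0) ≤ j / (N + 1) := by gcongr
    simp only [gridPt]
    rw [min_min_min_comm, min_eq_left this]
  have hmin' : ∀ {s t : ℝ≥0} {i j : ℕ}, j ≤ i →
      min (gridPt N s i) (gridPt N t j) = gridPt N (min s t) j := by
    intro s t i j hij
    rw [min_comm, hmin hij, min_comm]
  rw [covariance_increments hw]
  rcases lt_trichotomy k l with h | rfl | h
  · rw [if_neg h.ne, hmin (by omega), hmin (by omega), hmin (by omega), hmin (by omega)]
    ring
  · rw [if_pos rfl, hmin (by omega), hmin' (by omega), hmin (by omega), hmin (by omega)]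
    ring
  · rw [if_neg h.ne', hmin' (by omega), hmin' (by omega), hmin' (by omega), hmin' (by omega)]
    ring

lemma memLp_wienerSum {w : ℝ≥0 → Ω → ℝ} (hw : IsPreBrownianReal w μ) (N : ℕ) (f : ℝ → ℝ)
    (t : ℝ≥0) : MemLp (fun ω => wienerSum N f t (w · ω)) 2 μ :=
  memLp_finsetSum _ fun _ _ => MemLp.const_mul
    ((hw.isGaussianProcess.hasGaussianLaw_eval _).memLp_two.sub
      (hw.isGaussianProcess.hasGaussianLaw_eval _).memLp_two) _

lemma integral_wienerSum {w : ℝ≥0 → Ω → ℝ} (hw : IsPreBrownianReal w μ) (N : ℕ) (f : ℝ → ℝ)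
    (t : ℝ≥0) : ∫ ω, wienerSum N f t (w · ω) ∂μ = 0 := by
  have hi := hw.integrable_eval
  simp only [wienerSum]
  have hi' : ∀ a b (c : ℝ), Integrable (fun ω => c * (w a ω - w b ω)) μ := fun a b c =>
    ((hi a).sub (hi b)).const_mul c
  rw [integral_finsetSum _ fun k _ => hi' _ _ _]
  refine Finset.sum_eq_zero fun k _ => ?_
  rw [integral_const_mul]
  rw [integral_sub (hi _) (hi _), hw.integral_eval, hw.integral_eval]
  simp

lemma covariance_wienerSum {w : ℝ≥0 → Ω → ℝ} (hw : IsPreBrownianReal w μ) (N : ℕ)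
    (f g : ℝ → ℝ) (s t : ℝ≥0) :
    cov[fun ω => wienerSum N f s (w · ω), fun ω => wienerSum N g t (w · ω); μ]
      = ∑ k ∈ Finset.range ((N + 1) * (N + 1)),
        (f (gridPt N (min s t) k) * g (gridPt N (min s t) k)) *
          (gridPt N (min s t) (k + 1) - gridPt N (min s t) k) := by
  have := hw.isGaussianProcess.isProbabilityMeasure
  have hL : ∀ a b (c : ℝ), MemLp (fun ω => c * (w a ω - w b ω)) 2 μ := fun a b c =>
    MemLp.const_mul ((hw.isGaussianProcess.hasGaussianLaw_eval _).memLp_two.sub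
      (hw.isGaussianProcess.hasGaussianLaw_eval _).memLp_two) _
  simp only [wienerSum]
  rw [covariance_fun_sum_fun_sum' (fun _ _ => hL _ _ _) (fun _ _ => hL _ _ _)]
  refine Finset.sum_congr rfl fun k hk => ?_
  simp only [covariance_const_mul_left, covariance_const_mul_right, covariance_grid_increments hw]
  rw [Finset.sum_eq_single k (fun l _ hl => by simp [hl.symm]) (fun h => absurd hk h), if_pos rfl]
  -- If the cell starts at or after `min s t`, its stopped length is zero; otherwise the three
  -- stopped left endpoints coincide.
  rcases le_total (min s t) (k / (N + 1)) with h | h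
  · have h1 : gridPt N (min s t) k = min s t := min_eq_right h
    have h2 : gridPt N (min s t) (k + 1) = min s t :=
      le_antisymm (gridPt_le _ _ _) (h1.symm.le.trans (gridPt_mono N _ k.le_succ))
    rw [h1, h2]; ring
  · have h0 : gridPt N (min s t) k = k / (N + 1) := min_eq_left h
    have h1 : gridPt N s k = k / (N + 1) := min_eq_left (h.trans (min_le_left _ _))
    have h2 : gridPt N t k = k / (N + 1) := min_eq_left (h.trans (min_le_right _ _))
    rw [h0, h1, h2]; ring

omit [MeasurableSpace Ω] in
lemma wienerSum_mem_span {ι : Type*} {W : ι → ℝ≥0 → Ω → ℝ} (j : ι) (N : ℕ) (f : ℝ → ℝ)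
    (t : ℝ≥0) : (fun ω => wienerSum N f t (W j · ω)) ∈
      Submodule.span ℝ (Set.range fun (p : ι × ℝ≥0) ω => W p.1 p.2 ω) := by
  have : (fun ω => wienerSum N f t (W j · ω)) = ∑ k ∈ Finset.range ((N + 1) * (N + 1)),
      f (gridPt N t k) • (W j (gridPt N t (k + 1)) - W j (gridPt N t k)) := by
    ext ω; simp [wienerSum, Finset.sum_apply]
  rw [this]
  exact Submodule.sum_mem _ fun k _ => Submodule.smul_mem _ _ (Submodule.sub_mem _
    (Submodule.subset_span ⟨(j, _), rfl⟩) (Submodule.subset_span ⟨(j, _), rfl⟩))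

/-- Wiener integrals of deterministic functions with respect to a multidimensional Brownian motion
form a centered Gaussian process, whose covariances are given by the Itô isometry. -/
lemma isGaussianProcess_wienerInt [IsProbabilityMeasure μ] {n : ℕ} {W : Fin n → ℝ≥0 → Ω → ℝ}
    (hW : ∀ j, IsBrownianReal (W j) μ) (hind : iIndepFun (fun j ω t => W j t ω) μ) {α : Type*}
    (τ : α → ℝ≥0) {f f' : α → Fin n → ℝ → ℝ} (hf' : ∀ a j, Continuous (f' a j))
    (hf : ∀ a j x, HasDerivAt (f a j) (f' a j x) x) :
    IsGaussianProcess (fun a ω => ∑ j, wienerInt (f a j) (f' a j) (τ a) (W j · ω)) μ ∧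
    (∀ a, ∫ ω, ∑ j, wienerInt (f a j) (f' a j) (τ a) (W j · ω) ∂μ = 0) ∧
    ∀ a b, cov[fun ω => ∑ j, wienerInt (f a j) (f' a j) (τ a) (W j · ω),
        fun ω => ∑ j, wienerInt (f b j) (f' b j) (τ b) (W j · ω); μ]
      = ∑ j, ∫ u in (0 : ℝ)..(min (τ a) (τ b) : ℝ≥0), f a j u * f b j u := by
  have hpre : ∀ j, IsPreBrownianReal (W j) μ := fun j => (hW j).toIsPreBrownianReal
  have hjoint := isGaussianProcess_prod_of_iIndepFun
    (fun j => IsPreBrownianReal.isGaussianProcess (hpre j)) hind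
  have hL := fun j N (g : ℝ → ℝ) t => memLp_wienerSum (hpre j) N g t
  have hcont : ∀ a j, Continuous (f a j) := fun a j =>
    continuous_iff_continuousAt.2 fun x => (hf a j x).continuousAt
  refine isGaussianProcess_of_tendsto
    (G := fun N a ω => ∑ j, wienerSum N (f a j) (τ a) (W j · ω)) (fun N => ?_) (fun N a => ?_)
    (fun a b => ?_) (fun a => ?_)
  · refine IsGaussianProcess.of_mem_span hjoint fun a => ?_
    have : (fun ω => ∑ j, wienerSum N (f a j) (τ a) (W j · ω))
        = ∑ j, fun ω => wienerSum N (f a j) (τ a) (W j · ω) := by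
      ext ω; simp [Finset.sum_apply]
    rw [this]
    exact Submodule.sum_mem _ fun j _ => wienerSum_mem_span j N _ _
  · rw [integral_finsetSum _ fun j _ => (hL j N _ _).integrable one_le_two]
    exact Finset.sum_eq_zero fun j _ => integral_wienerSum (hpre j) _ _ _
  · have hcov : ∀ N, cov[fun ω => ∑ j, wienerSum N (f a j) (τ a) (W j · ω),
        fun ω => ∑ j, wienerSum N (f b j) (τ b) (W j · ω); μ]
        = ∑ j, ∑ k ∈ Finset.range ((N + 1) * (N + 1)),
        (f a j (gridPt N (min (τ a) (τ b)) k) * f b j (gridPt N (min (τ a) (τ b)) k)) *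
          (gridPt N (min (τ a) (τ b)) (k + 1) - gridPt N (min (τ a) (τ b)) k) := by
      intro N
      rw [covariance_fun_sum_fun_sum (fun j => hL j N _ _) (fun j => hL j N _ _)]
      refine Finset.sum_congr rfl fun j _ => ?_
      rw [Finset.sum_eq_single j (fun i _ hij => ?_) (by simp), covariance_wienerSum (hpre j)]
      refine IndepFun.covariance_eq_zero ?_ (hL j N _ _) (hL i N _ _)
      have hm : ∀ g t, Measurable (wienerSum N g t) := fun g t => by
        unfold wienerSum; fun_prop
      exact (hind.indepFun hij.symm).comp (hm _ _) (hm _ _)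
    simp only [hcov]
    refine tendsto_finsetSum _ fun j _ => ?_
    have := tendsto_riemannStieltjes (h := fun u => f a j u * f b j u) (F := id)
      (F' := fun _ => 1) ((hcont a j).mul (hcont b j)) continuous_const hasDerivAt_id
      (min (τ a) (τ b)) (ξ := fun N k => gridPt N (min (τ a) (τ b)) k)
      (fun N k => ⟨le_rfl, gridPt_mono N _ k.le_succ⟩)
    simpa using this
  · filter_upwards [ae_all_iff.2 fun j => (hW j).cont,
      ae_all_iff.2 fun j => (hpre j).eval_zero_ae_eq_zero] with ω h1 h2
    exact tendsto_finsetSum _ fun j _ =>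
      tendsto_wienerSum (hf' a j) (hf a j) (τ a) (h1 j) (h2 j)

end Wiener

/-! ### The law of the Ornstein-Uhlenbeck process -/

section OU

variable {Ω : Type*} [MeasurableSpace Ω] {μ : Measure Ω} {d n : ℕ}
  {Θ : Matrix (Fin d) (Fin d) ℝ} {L : Matrix (Fin d) (Fin n) ℝ} {a : Fin d → ℝ}

lemma covariance_congr_ae {f f' g g' : Ω → ℝ} (hf : f =ᵐ[μ] f') (hg : g =ᵐ[μ] g') :
    cov[f, g; μ] = cov[f', g'; μ] := by
  rw [covariance, covariance, integral_congr_ae hf, integral_congr_ae hg]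
  refine integral_congr_ae ?_
  filter_upwards [hf, hg] with ω h1 h2
  rw [h1, h2]

lemma hasDerivAt_expM_sub_mul_apply (Θ : Matrix (Fin d) (Fin d) ℝ) (L : Matrix (Fin d) (Fin n) ℝ)
    (t : ℝ) (i : Fin d) (j : Fin n) (r : ℝ) :
    HasDerivAt (fun r => (expM Θ (r - t) * L) i j) ((Θ * expM Θ (r - t) * L) i j) r := by
  have h : HasDerivAt (fun r => ∑ k, expM Θ (r - t) i k * L k j)
      (∑ k, (Θ * expM Θ (r - t)) i k * L k j) r := HasDerivAt.fun_sum fun k _ =>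
    ((hasDerivAt_expM_apply Θ i k (r - t)).comp_sub_const r t).mul_const _
  exact h

/-- Variation of constants. -/
lemma ou_path_eq {x : ℝ≥0 → Fin d → ℝ} {w : Fin n → ℝ≥0 → ℝ} (hx : Continuous x)
    (hw : ∀ j, Continuous (w j))
    (h : ∀ t : ℝ≥0, x t = a - (∫ s in (0 : ℝ)..t, Θ *ᵥ x s.toNNReal) + L *ᵥ fun j => w j t)
    (t : ℝ≥0) (i : Fin d) :
    x t i = (expM Θ (-t) *ᵥ a) i + ∑ j, wienerInt (fun r => (expM Θ (r - t) * L) i j)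
      (fun r => (Θ * expM Θ (r - t) * L) i j) t (w j) := by
  have hcont : Continuous fun s : ℝ => Θ *ᵥ x s.toNNReal := by fun_prop
  -- `V` is the path minus its noise `L w`. Unlike the path it is differentiable, so the fundamental
  -- theorem of calculus applies to `exp((r - t) Θ) V(r)`.
  set V : ℝ → Fin d → ℝ := fun r => a - ∫ s in (0 : ℝ)..r, Θ *ᵥ x s.toNNReal with hV
  have hVd : ∀ r, HasDerivAt V (-(Θ *ᵥ x r.toNNReal)) r := fun r =>
    (hcont.integral_hasStrictDerivAt 0 r).hasDerivAt.const_sub a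
  have hVdi : ∀ r k, HasDerivAt (fun r => V r k) (-(Θ *ᵥ x r.toNNReal) k) r := fun r k =>
    hasDerivAt_pi.1 (hVd r) k
  have hVc : Continuous V := continuous_iff_continuousAt.2 fun r => (hVd r).continuousAt
  have hxV : ∀ r : ℝ, 0 ≤ r → x r.toNNReal = V r + L *ᵥ fun j => w j r.toNNReal := by
    intro r hr
    rw [h, Real.coe_toNNReal _ hr]
  have hEd : ∀ r, HasDerivAt (fun r => ∑ k, expM Θ (r - t) i k * V r k)
      (∑ k, ((Θ * expM Θ (r - t)) i k * V r k
        + expM Θ (r - t) i k * -(Θ *ᵥ x r.toNNReal) k)) r := fun r =>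
    HasDerivAt.fun_sum fun k _ =>
      ((hasDerivAt_expM_apply Θ i k (r - t)).comp_sub_const r t).mul (hVdi r k)
  have hint := intervalIntegral.integral_eq_sub_of_hasDerivAt (a := (0 : ℝ)) (b := t)
    (fun r _ => hEd r) (Continuous.intervalIntegrable (by fun_prop) _ _)
  have hintegrand : ∀ r ∈ Set.uIcc (0 : ℝ) t, ∑ k, ((Θ * expM Θ (r - t)) i k * V r k
        + expM Θ (r - t) i k * -(Θ *ᵥ x r.toNNReal) k)
      = -∑ j, w j r.toNNReal * (Θ * expM Θ (r - t) * L) i j := by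
    intro r hr
    rw [Set.uIcc_of_le t.coe_nonneg] at hr
    have h1 : ∑ k, ((Θ * expM Θ (r - t)) i k * V r k
        + expM Θ (r - t) i k * -(Θ *ᵥ x r.toNNReal) k)
        = ((Θ * expM Θ (r - t)) *ᵥ V r) i - (expM Θ (r - t) *ᵥ (Θ *ᵥ x r.toNNReal)) i := by
      simp only [Matrix.mulVec, dotProduct, ← Finset.sum_sub_distrib]
      exact Finset.sum_congr rfl fun k _ => by ring
    -- The drift cancels since `Θ` commutes with its exponential; only the noise part of the path
    -- survives.
    rw [h1, Matrix.mulVec_mulVec, ← mul_expM_comm, hxV r hr.1, Matrix.mulVec_add,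
      Matrix.mulVec_mulVec, Pi.add_apply, sub_add_cancel_left]
    simp only [Matrix.mulVec, dotProduct]
    congr 1
    exact Finset.sum_congr rfl fun j _ => mul_comm _ _
  rw [intervalIntegral.integral_congr hintegrand, intervalIntegral.integral_neg,
    intervalIntegral.integral_finsetSum fun j _ =>
      Continuous.intervalIntegrable (by fun_prop) _ _] at hint
  have hV0 : V 0 = a := by simp [hV]
  have hEt : ∑ k, expM Θ ((t : ℝ) - t) i k * V t k = V t i := by
    rw [sub_self, expM_zero]
    simp [Matrix.one_apply]
  have hE0 : ∑ k, expM Θ ((0 : ℝ) - t) i k * V 0 k = (expM Θ (-t) *ᵥ a) i := by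
    rw [hV0, zero_sub]; rfl
  rw [hEt, hE0] at hint
  have hxt : x t i = V t i + ∑ j, L i j * w j t := by
    have := congrFun (hxV t t.2) i
    rwa [Real.toNNReal_coe] at this
  simp only [wienerInt, sub_self, expM_zero, Matrix.one_mul, Finset.sum_sub_distrib]
  rw [hxt]
  linarith

/-- By variation of constants, `X(t)` is almost surely `exp(-t Θ) a` plus the Wiener integral of
`exp((r - t) Θ) L`; the Itô isometry then yields `ouCov`. -/
lemma IsOU.isGaussianProcess [IsProbabilityMeasure μ] {X : ℝ≥0 → Ω → Fin d → ℝ}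
    (hX : IsOU Θ L a X μ) :
    IsGaussianProcess (fun (p : ℝ≥0 × Fin d) ω => X p.1 ω p.2) μ ∧
    (∀ t i, ∫ ω, X t ω i ∂μ = (expM Θ (-t) *ᵥ a) i) ∧
    ∀ s t i j, cov[fun ω => X s ω i, fun ω => X t ω j; μ] = ouCov Θ (L * Lᵀ) s t i j := by
  obtain ⟨W, hWm, hW, hind, hsde⟩ := hX.sde
  obtain ⟨h1, h2, h3⟩ := isGaussianProcess_wienerInt hW hind (fun p : ℝ≥0 × Fin d => p.1)
    (f := fun p j r => (expM Θ (r - p.1) * L) p.2 j)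
    (f' := fun p j r => (Θ * expM Θ (r - p.1) * L) p.2 j)
    (fun p j => by fun_prop) (fun p j => hasDerivAt_expM_sub_mul_apply Θ L p.1 p.2 j)
  have hae : ∀ p : ℝ≥0 × Fin d, (fun ω => ∑ j, wienerInt (fun r => (expM Θ (r - p.1) * L) p.2 j)
      (fun r => (Θ * expM Θ (r - p.1) * L) p.2 j) p.1 (W j · ω) + (expM Θ (-p.1) *ᵥ a) p.2)
      =ᵐ[μ] fun ω => X p.1 ω p.2 := by
    intro p
    filter_upwards [hX.continuous, ae_all_iff.2 fun j => (hW j).cont, hsde] with ω hx hw h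
    rw [ou_path_eq hx hw h, add_comm]
  have hint : ∀ p : ℝ≥0 × Fin d, Integrable (fun ω => ∑ j, wienerInt
      (fun r => (expM Θ (r - p.1) * L) p.2 j)
      (fun r => (Θ * expM Θ (r - p.1) * L) p.2 j) p.1 (W j · ω)) μ := fun p =>
    (h1.hasGaussianLaw_eval p).integrable
  refine ⟨(IsGaussianProcess.add_const h1 _).congr hae, fun t i => ?_, fun s t i j => ?_⟩
  · rw [← integral_congr_ae (hae (t, i)), integral_add (hint (t, i)) (integrable_const _),
      h2 (t, i), zero_add, integral_const]
    simp
  · rw [← covariance_congr_ae (hae (s, i)) (hae (t, j)), covariance_add_const_left (hint (s, i)),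
      covariance_add_const_right (hint (t, j)), h3 (s, i) (t, j), ouCov_apply,
      ← intervalIntegral.integral_finsetSum fun k _ =>
        Continuous.intervalIntegrable (by fun_prop) _ _]
    refine intervalIntegral.integral_congr fun u _ => ?_
    simp only
    rw [← Matrix.mul_assoc, Matrix.mul_assoc, ← Matrix.transpose_mul, Matrix.mul_apply]
    rfl

lemma IsOU.ae_zero_eq {X : ℝ≥0 → Ω → Fin d → ℝ} (hX : IsOU Θ L a X μ) :
    ∀ᵐ ω ∂μ, X 0 ω = a := by
  obtain ⟨W, -, hW, -, hsde⟩ := hX.sde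
  filter_upwards [hsde, ae_all_iff.2 fun j => (hW j).toIsPreBrownianReal.eval_zero_ae_eq_zero]
    with ω h h0
  rw [h 0]
  have : (fun j => W j 0 ω) = 0 := funext h0
  rw [this]
  simp

/-- The noiseless equation in integral form, so that this curve can be added to a solution without
changing the Brownian motion. -/
lemma expM_neg_mulVec_eq (Θ : Matrix (Fin d) (Fin d) ℝ) (c : Fin d → ℝ) (t : ℝ) :
    expM Θ (-t) *ᵥ c = c - ∫ s in (0 : ℝ)..t, Θ *ᵥ (expM Θ (-s) *ᵥ c) := by
  have hd : ∀ s, HasDerivAt (fun s => expM Θ (-s) *ᵥ c) (-(Θ *ᵥ (expM Θ (-s) *ᵥ c))) s := by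
    intro s
    refine hasDerivAt_pi.2 fun i => ?_
    have : HasDerivAt (fun s => ∑ k, expM Θ (-s) i k * c k)
        (∑ k, -(Θ * expM Θ (-s)) i k * c k) s := HasDerivAt.fun_sum fun k _ => by
      have := (hasDerivAt_expM_apply Θ i k (-s)).scomp s (hasDerivAt_neg s)
      simp only [smul_eq_mul, neg_one_mul] at this
      exact this.mul_const _
    refine this.congr_deriv ?_
    rw [Matrix.mulVec_mulVec]
    simp [Matrix.mulVec, dotProduct]
  have := intervalIntegral.integral_eq_sub_of_hasDerivAt (a := (0 : ℝ)) (b := t)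
    (fun r _ => hd r) (Continuous.intervalIntegrable (by fun_prop) _ _)
  rw [intervalIntegral.integral_neg] at this
  simp only [neg_zero, expM_zero, Matrix.one_mulVec] at this
  rw [sub_eq_add_neg, this]
  abel

/-- Changing the starting point of an Ornstein-Uhlenbeck process. -/
lemma IsOU.add_expM {X : ℝ≥0 → Ω → Fin d → ℝ} (hX : IsOU Θ L a X μ) (c : Fin d → ℝ) :
    IsOU Θ L (a + c) (fun t ω => X t ω + expM Θ (-t) *ᵥ c) μ where
  measurable t := (hX.measurable t).add_const _
  continuous := by
    filter_upwards [hX.continuous] with ω h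
    fun_prop
  sde := by
    obtain ⟨W, hWm, hW, hind, hsde⟩ := hX.sde
    refine ⟨W, hWm, hW, hind, ?_⟩
    filter_upwards [hX.continuous, hsde] with ω hx h t
    have h1 : ∫ s in (0 : ℝ)..t, Θ *ᵥ (X s.toNNReal ω + expM Θ (-(s.toNNReal : ℝ)) *ᵥ c)
        = (∫ s in (0 : ℝ)..t, Θ *ᵥ X s.toNNReal ω)
          + ∫ s in (0 : ℝ)..t, Θ *ᵥ (expM Θ (-s) *ᵥ c) := by
      rw [← intervalIntegral.integral_add (Continuous.intervalIntegrable (by fun_prop) _ _)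
        (Continuous.intervalIntegrable (by fun_prop) _ _)]
      refine intervalIntegral.integral_congr fun s hs => ?_
      rw [Set.uIcc_of_le t.coe_nonneg] at hs
      simp only [Real.coe_toNNReal _ hs.1, Matrix.mulVec_add]
    rw [h1, h t, expM_neg_mulVec_eq Θ c t]
    abel

end OU

/-! ### Conditioning on a variable from which the process is affinely decoupled -/

section Conditioning

variable {Ω : Type*} [MeasurableSpace Ω] {μ : Measure Ω} {d m : ℕ} {ι : Type*}

lemma measurable_add_mulVec (A : ι → Matrix (Fin d) (Fin m) ℝ) :
    Measurable fun (p : (Fin m → ℝ) × (ι → Fin d → ℝ)) t => p.2 t + A t *ᵥ p.1 := by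
  fun_prop

/-- The kernel `w ↦ law of (R t + A t w)_t` where `R` has law `ρ`. -/
noncomputable def affineKernel (ρ : Measure (ι → Fin d → ℝ)) (A : ι → Matrix (Fin d) (Fin m) ℝ) :
    Kernel (Fin m → ℝ) (ι → Fin d → ℝ) :=
  (Kernel.id ×ₖ Kernel.const (Fin m → ℝ) ρ).map fun p t => p.2 t + A t *ᵥ p.1

lemma affineKernel_apply (ρ : Measure (ι → Fin d → ℝ)) [SFinite ρ]
    (A : ι → Matrix (Fin d) (Fin m) ℝ) (w : Fin m → ℝ) :
    affineKernel ρ A w = ρ.map fun r t => r t + A t *ᵥ w := by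
  rw [affineKernel, Kernel.map_apply _ (measurable_add_mulVec A), Kernel.prod_apply,
    Kernel.id_apply, Kernel.const_apply, Measure.dirac_prod, Measure.map_map
      (measurable_add_mulVec A) (by fun_prop)]
  rfl

instance (ρ : Measure (ι → Fin d → ℝ)) [IsProbabilityMeasure ρ]
    (A : ι → Matrix (Fin d) (Fin m) ℝ) : IsMarkovKernel (affineKernel ρ A) :=
  Kernel.IsMarkovKernel.map _ (measurable_add_mulVec A)

/-- Writing `X = R + A U` with `R` independent of `U`, freezing `U` at `w` leaves the law of `R + A
w`. -/
lemma hasCondDistrib_affineKernel [IsProbabilityMeasure μ] {X : ι → Ω → Fin d → ℝ}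
    {U : Ω → Fin m → ℝ} (hX : ∀ t, Measurable (X t)) (hU : Measurable U)
    {A : ι → Matrix (Fin d) (Fin m) ℝ} (hind : IndepFun (fun ω t => X t ω - A t *ᵥ U ω) U μ) :
    HasCondDistrib (fun ω t => X t ω) U
      (affineKernel (μ.map fun ω t => X t ω - A t *ᵥ U ω) A) μ where
  aemeasurable := by fun_prop
  map_eq := by
    have hR : Measurable fun ω t => X t ω - A t *ᵥ U ω := by fun_prop
    have := Measure.isProbabilityMeasure_map (μ := μ) hR.aemeasurable
    have := Measure.isProbabilityMeasure_map (μ := μ) hU.aemeasurable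
    have h1 := (indepFun_iff_map_prod_eq_prod_map_map hU.aemeasurable hR.aemeasurable).1 hind.symm
    have hΨ : Measurable fun p : (Fin m → ℝ) × (ι → Fin d → ℝ) =>
        (p.1, fun t => p.2 t + A t *ᵥ p.1) := by fun_prop
    have h2 : (μ.map fun ω => (U ω, fun t => X t ω)) = (μ.map fun ω =>
        (U ω, fun t => X t ω - A t *ᵥ U ω)).map fun p => (p.1, fun t => p.2 t + A t *ᵥ p.1) := by
      rw [Measure.map_map hΨ (by fun_prop)]
      congr 1
      ext ω : 1
      simp
    rw [h2, h1]
    ext s hs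
    rw [Measure.map_apply hΨ hs, Measure.prod_apply (hΨ hs), Measure.compProd_apply hs]
    refine lintegral_congr fun w => ?_
    rw [affineKernel_apply, Measure.map_apply (by fun_prop) (measurable_prodMk_left hs)]
    rfl

lemma continuous_integral_affineKernel (ρ : Measure (ι → Fin d → ℝ)) [IsProbabilityMeasure ρ]
    (A : ι → Matrix (Fin d) (Fin m) ℝ) (I : Finset ι) (f : (I → Fin d → ℝ) →ᵇ ℝ) :
    Continuous fun w => ∫ x, f (I.restrict x) ∂(affineKernel ρ A w) := by
  have hf : Measurable fun x : ι → Fin d → ℝ => f (I.restrict x) :=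
    f.continuous.measurable.comp (Finset.measurable_restrict I)
  have h : ∀ w, ∫ x, f (I.restrict x) ∂(affineKernel ρ A w)
      = ∫ r, f (I.restrict fun t => r t + A t *ᵥ w) ∂ρ := by
    intro w
    rw [affineKernel_apply, integral_map (Measurable.aemeasurable (by fun_prop))
      hf.aestronglyMeasurable]
  simp only [h]
  refine continuous_of_dominated (bound := fun _ => ‖f‖) (fun w => ?_)
    (fun w => ae_of_all _ fun r => f.norm_coe_le_norm _) (integrable_const _)
    (ae_of_all _ fun r => ?_)
  · have hm : Measurable fun (r : ι → Fin d → ℝ) t => r t + A t *ᵥ w := by fun_prop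
    exact (hf.comp hm).aestronglyMeasurable
  · refine f.continuous.comp ?_
    simp only [Finset.restrict_def]
    fun_prop

/-- Any admissible kernel agrees with the affine one for almost every value, on each finite set of
times. Integrals of bounded continuous functions are continuous in the value for both kernels, and
the law of `U` charges every open set, so they agree at every value. -/
lemma isConditionedProcess_iff [IsProbabilityMeasure μ] {X : ι → Ω → Fin d → ℝ}
    {U : Ω → Fin m → ℝ} (hX : ∀ t, Measurable (X t)) (hU : Measurable U)
    {A : ι → Matrix (Fin d) (Fin m) ℝ} (hind : IndepFun (fun ω t => X t ω - A t *ᵥ U ω) U μ)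
    (hsupp : (μ.map U).IsOpenPosMeasure) {Ω' : Type*} [MeasurableSpace Ω'] {ν : Measure Ω'}
    {B : ι → Ω' → Fin d → ℝ} {u : Fin m → ℝ} :
    IsConditionedProcess X U u μ B ν ↔
      HasLaw (fun ω t => B t ω) (μ.map fun ω t => X t ω - A t *ᵥ U ω + A t *ᵥ u) ν := by
  have hR : Measurable fun ω t => X t ω - A t *ᵥ U ω := by fun_prop
  set ρ := μ.map fun ω t => X t ω - A t *ᵥ U ω with hρ
  have := Measure.isProbabilityMeasure_map (μ := μ) hR.aemeasurable
  have := Measure.isProbabilityMeasure_map (μ := μ) hU.aemeasurable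
  have hcd := hasCondDistrib_affineKernel hX hU hind
  have hu : (μ.map fun ω t => X t ω - A t *ᵥ U ω + A t *ᵥ u) = affineKernel ρ A u := by
    rw [affineKernel_apply, hρ, Measure.map_map (by fun_prop) hR]
    rfl
  rw [hu]
  refine ⟨fun ⟨κ, hκ, hκd, hκc, hus, hB⟩ => ?_, fun hB => ⟨affineKernel ρ A, inferInstance, hcd,
    fun I f => (continuous_integral_affineKernel ρ A I f).continuousOn, ?_, hB⟩⟩
  · suffices h : κ u = affineKernel ρ A u by rwa [← h]
    refine IsProjectiveLimit.unique (P := fun I : Finset ι => (affineKernel ρ A u).map I.restrict)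
      (fun I => ?_) (fun I => rfl)
    have hr := Finset.measurable_restrict (X := fun _ : ι => Fin d → ℝ) I
    have h1 := (hκd.comp_left hr).map_eq.symm.trans (hcd.comp_left hr).map_eq
    have h2 := Kernel.ae_eq_of_compProd_eq h1
    have := Measure.isProbabilityMeasure_map (μ := κ u) hr.aemeasurable
    have := Measure.isProbabilityMeasure_map (μ := affineKernel ρ A u) hr.aemeasurable
    refine ext_of_forall_integral_eq_of_IsFiniteMeasure fun f => ?_
    have hint : ∀ η : Measure (ι → Fin d → ℝ), ∫ x, f x ∂(η.map I.restrict)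
        = ∫ x, f (I.restrict x) ∂η := fun η =>
      integral_map hr.aemeasurable f.continuous.measurable.aestronglyMeasurable
    have h3 : (fun w => ∫ x, f (I.restrict x) ∂(κ w))
        =ᵐ[μ.map U] fun w => ∫ x, f (I.restrict x) ∂(affineKernel ρ A w) := by
      filter_upwards [h2] with w hw
      rw [Kernel.map_apply _ hr, Kernel.map_apply _ hr] at hw
      rw [← hint, hw, hint]
    have hc := hκc I f
    rw [Measure.support_eq_univ, continuousOn_univ] at hc
    rw [hint, hint]
    exact congrFun ((hc.ae_eq_iff_eq _ (continuous_integral_affineKernel ρ A I f)).1 h3) u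
  · rw [Measure.support_eq_univ]; trivial

/-- If `Z - A U` is independent of `U`, its covariance matrix is the conditional covariance matrix
of `Z` given `U`. -/
lemma condCovMatrix_ae_eq [IsProbabilityMeasure μ] {Z : Ω → Fin d → ℝ} {U : Ω → Fin m → ℝ}
    (hZ : Measurable Z) (hU : Measurable U) {A : Matrix (Fin d) (Fin m) ℝ}
    (hind : IndepFun (fun ω => Z ω - A *ᵥ U ω) U μ) (hZL : ∀ i, MemLp (fun ω => Z ω i) 2 μ)
    (hUL : ∀ i, MemLp (fun ω => U ω i) 2 μ) :
    ∀ᵐ ω ∂μ, condCovMatrix Z U μ ω = Matrix.of fun i j =>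
      cov[fun ω => (Z ω - A *ᵥ U ω) i, fun ω => (Z ω - A *ᵥ U ω) j; μ] := by
  set R : Ω → Fin d → ℝ := fun ω => Z ω - A *ᵥ U ω with hR
  have hRm : Measurable R := by fun_prop
  have hAU : ∀ i, MemLp (fun ω => (A *ᵥ U ω) i) 2 μ := fun i => by
    simp only [Matrix.mulVec, dotProduct]
    exact memLp_finsetSum _ fun k _ => (hUL k).const_mul _
  have hRL : ∀ i, MemLp (fun ω => R ω i) 2 μ := fun i => (hZL i).sub (hAU i)
  have hle := hU.comap_le
  set 𝓂 : MeasurableSpace Ω := MeasurableSpace.comap U inferInstance with h𝓂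
  have hUm : Measurable[𝓂] U := comap_measurable U
  have hind' : Indep (MeasurableSpace.comap R inferInstance) 𝓂 μ := hind
  -- Hence `Z` minus its conditional mean is the centered residual, which is independent of `U`; its
  -- conditional covariances are therefore constants.
  have hmean : ∀ i, μ[fun ω => Z ω i | 𝓂] =ᵐ[μ]
      fun ω => (A *ᵥ U ω) i + ∫ ω', R ω' i ∂μ := by
    intro i
    have h0 : (fun ω => Z ω i) = (fun ω => (A *ᵥ U ω) i) + fun ω => R ω i := by
      ext ω; simp [hR]
    have hm : Measurable[𝓂] fun ω => (A *ᵥ U ω) i :=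
      Measurable.comp (g := fun u => (A *ᵥ u) i) (by fun_prop) hUm
    have h1 : μ[fun ω => (A *ᵥ U ω) i | 𝓂] = fun ω => (A *ᵥ U ω) i :=
      condExp_of_stronglyMeasurable hle hm.stronglyMeasurable ((hAU i).integrable one_le_two)
    have h2 : μ[fun ω => R ω i | 𝓂] =ᵐ[μ] fun _ => ∫ ω', R ω' i ∂μ :=
      condExp_indep_eq hRm.comap_le hle
        (((measurable_pi_apply i).comp (comap_measurable R)).stronglyMeasurable) hind'
    rw [h0]
    refine (condExp_add ((hAU i).integrable one_le_two) ((hRL i).integrable one_le_two) 𝓂).trans ?_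
    rw [h1]
    filter_upwards [h2] with ω hω
    rw [Pi.add_apply, hω]
  have hcov : ∀ i j, μ[fun ω => (Z ω i - (μ[fun ω => Z ω i | 𝓂]) ω)
      * (Z ω j - (μ[fun ω => Z ω j | 𝓂]) ω) | 𝓂] =ᵐ[μ]
      fun _ => cov[fun ω => R ω i, fun ω => R ω j; μ] := by
    intro i j
    have h1 : (fun ω => (Z ω i - (μ[fun ω => Z ω i | 𝓂]) ω)
        * (Z ω j - (μ[fun ω => Z ω j | 𝓂]) ω)) =ᵐ[μ]
        fun ω => (R ω i - ∫ ω', R ω' i ∂μ) * (R ω j - ∫ ω', R ω' j ∂μ) := by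
      filter_upwards [hmean i, hmean j] with ω hi hj
      rw [hi, hj]
      simp only [hR, Pi.sub_apply]
      ring
    refine (condExp_congr_ae h1).trans ?_
    have hm : Measurable fun v : Fin d → ℝ =>
        (v i - ∫ ω', R ω' i ∂μ) * (v j - ∫ ω', R ω' j ∂μ) := by fun_prop
    exact condExp_indep_eq hRm.comap_le hle
      ((hm.comp (comap_measurable R)).stronglyMeasurable) hind'
  filter_upwards [ae_all_iff.2 fun i => ae_all_iff.2 fun j => hcov i j] with ω hω
  ext i j
  exact hω i j

end Conditioning

/-! ### Gaussian vector processes with given mean and covariance -/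

section GaussianWith

variable {Ω : Type*} [MeasurableSpace Ω] {μ : Measure Ω} {d : ℕ} {ι : Type*}

/-- `G` is a Gaussian process with values in `ℝᵈ`, with mean function `m` and covariance
function `c`. -/
structure IsGaussianWith (G : ι → Ω → Fin d → ℝ) (m : ι → Fin d → ℝ)
    (c : ι → ι → Matrix (Fin d) (Fin d) ℝ) (μ : Measure Ω) : Prop where
  aemeasurable : AEMeasurable (fun ω t => G t ω) μ
  isGaussianProcess : IsGaussianProcess (fun (p : ι × Fin d) ω => G p.1 ω p.2) μ
  mean : ∀ t i, ∫ ω, G t ω i ∂μ = m t i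
  cov : ∀ s t i j, cov[fun ω => G s ω i, fun ω => G t ω j; μ] = c s t i j

variable {G : ι → Ω → Fin d → ℝ} {m : ι → Fin d → ℝ} {c : ι → ι → Matrix (Fin d) (Fin d) ℝ}

lemma IsGaussianWith.integrable (hG : IsGaussianWith G m c μ) (t : ι) (i : Fin d) :
    Integrable (fun ω => G t ω i) μ :=
  (hG.isGaussianProcess.hasGaussianLaw_eval (t, i)).integrable

lemma IsGaussianWith.add_const (hG : IsGaussianWith G m c μ) (b : ι → Fin d → ℝ) :
    IsGaussianWith (fun t ω => G t ω + b t) (m + b) c μ where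
  aemeasurable := hG.aemeasurable.add_const b
  isGaussianProcess := IsGaussianProcess.add_const hG.isGaussianProcess fun p => b p.1 p.2
  mean t i := by
    have := hG.isGaussianProcess.isProbabilityMeasure
    simp only [Pi.add_apply]
    rw [integral_add (hG.integrable t i) (integrable_const _), hG.mean, integral_const]
    simp
  cov s t i j := by
    have := hG.isGaussianProcess.isProbabilityMeasure
    simp only [Pi.add_apply]
    rw [covariance_add_const_left (hG.integrable s i), covariance_add_const_right
      (hG.integrable t j), hG.cov]

/-- Means and covariances determine a Gaussian law, so equality of process laws reduces to equality
of these two functions. -/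
lemma IsGaussianWith.hasLaw_iff (hG : IsGaussianWith G m c μ) {Ω' : Type*} [MeasurableSpace Ω']
    {ν : Measure Ω'} {B : ι → Ω' → Fin d → ℝ} :
    HasLaw (fun ω t => B t ω) (μ.map fun ω t => G t ω) ν ↔ IsGaussianWith B m c ν := by
  have he : ∀ p : ι × Fin d, Measurable fun x : ι → Fin d → ℝ => x p.1 p.2 := by fun_prop
  refine ⟨fun h => ?_, fun h => ⟨h.aemeasurable, ?_⟩⟩
  · have hid : IdentDistrib (fun ω t => B t ω) (fun ω t => G t ω) ν μ :=
      ⟨h.aemeasurable, hG.aemeasurable, h.map_eq⟩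
    refine ⟨h.aemeasurable, ⟨fun I => ⟨?_⟩⟩, fun t i => ?_, fun s t i j => ?_⟩
    · have hI := (hid.comp (u := fun x => I.restrict fun p : ι × Fin d => x p.1 p.2)
        (by fun_prop)).map_eq
      have h2 := (hG.isGaussianProcess.hasGaussianLaw I).isGaussian_map
      rw [← show _ = μ.map fun ω => I.restrict fun p : ι × Fin d => G p.1 ω p.2 from hI] at h2
      exact h2
    · rw [← hG.mean]
      exact (hid.comp (he (t, i))).integral_eq
    · rw [← hG.cov]
      have h1 : ∀ p : ι × Fin d, ∫ ω, B p.1 ω p.2 ∂ν = ∫ ω, G p.1 ω p.2 ∂μ := fun p =>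
        (hid.comp (he p)).integral_eq
      rw [covariance, covariance, h1 (s, i), h1 (t, j)]
      exact (hid.comp (((he (s, i)).sub_const (∫ ω, G s ω i ∂μ)).mul
        ((he (t, j)).sub_const (∫ ω, G t ω j ∂μ)))).integral_eq
  · have hm1 : AEMeasurable (fun ω (p : ι × Fin d) => B p.1 ω p.2) ν :=
      (MeasurableEquiv.curry ι (Fin d) ℝ).symm.measurable.comp_aemeasurable h.aemeasurable
    have hm2 : AEMeasurable (fun ω (p : ι × Fin d) => G p.1 ω p.2) μ :=
      (MeasurableEquiv.curry ι (Fin d) ℝ).symm.measurable.comp_aemeasurable hG.aemeasurable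
    have key := IsGaussianProcess.map_eq (IsGaussianWith.isGaussianProcess h)
      hG.isGaussianProcess hm1 hm2
      (fun p => by rw [h.mean, hG.mean]) (fun p q => by rw [h.cov, hG.cov])
    have := congrArg (Measure.map (MeasurableEquiv.curry ι (Fin d) ℝ)) key
    rw [AEMeasurable.map_map_of_aemeasurable
        (MeasurableEquiv.curry ι (Fin d) ℝ).measurable.aemeasurable hm1,
      AEMeasurable.map_map_of_aemeasurable
        (MeasurableEquiv.curry ι (Fin d) ℝ).measurable.aemeasurable hm2] at this
    exact this

end GaussianWith

/-! ### Cross-covariance matrices and conditioning of Gaussian processes -/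

section CrossCov

variable {Ω : Type*} [MeasurableSpace Ω] {μ : Measure Ω} {p q r : ℕ}

/-- The cross-covariance matrix of two random vectors. -/
noncomputable def crossCov (F : Ω → Fin p → ℝ) (G : Ω → Fin q → ℝ) (μ : Measure Ω) :
    Matrix (Fin p) (Fin q) ℝ :=
  Matrix.of fun i j => cov[fun ω => F ω i, fun ω => G ω j; μ]

lemma crossCov_transpose (F : Ω → Fin p → ℝ) (G : Ω → Fin q → ℝ) :
    (crossCov F G μ)ᵀ = crossCov G F μ := by
  ext i j; exact covariance_comm _ _

lemma memLp_mulVec {F : Ω → Fin p → ℝ} (hF : ∀ i, MemLp (fun ω => F ω i) 2 μ)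
    (A : Matrix (Fin r) (Fin p) ℝ) (i : Fin r) : MemLp (fun ω => (A *ᵥ F ω) i) 2 μ := by
  simp only [Matrix.mulVec, dotProduct]
  exact memLp_finsetSum _ fun k _ => (hF k).const_mul _

variable [IsFiniteMeasure μ]

lemma crossCov_mulVec_left {F : Ω → Fin p → ℝ} {G : Ω → Fin q → ℝ}
    (hF : ∀ i, MemLp (fun ω => F ω i) 2 μ) (hG : ∀ i, MemLp (fun ω => G ω i) 2 μ)
    (A : Matrix (Fin r) (Fin p) ℝ) :
    crossCov (fun ω => A *ᵥ F ω) G μ = A * crossCov F G μ := by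
  ext i j
  simp only [crossCov, Matrix.of_apply, Matrix.mulVec, dotProduct, Matrix.mul_apply]
  rw [covariance_fun_sum_left (fun k => (hF k).const_mul _) (hG j)]
  simp only [covariance_const_mul_left]

lemma crossCov_sub_left {F F' : Ω → Fin p → ℝ} {G : Ω → Fin q → ℝ}
    (hF : ∀ i, MemLp (fun ω => F ω i) 2 μ) (hF' : ∀ i, MemLp (fun ω => F' ω i) 2 μ)
    (hG : ∀ i, MemLp (fun ω => G ω i) 2 μ) :
    crossCov (fun ω => F ω - F' ω) G μ = crossCov F G μ - crossCov F' G μ := by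
  ext i j
  exact covariance_fun_sub_left (hF i) (hF' i) (hG j)

lemma crossCov_sub_right {F : Ω → Fin p → ℝ} {G G' : Ω → Fin q → ℝ}
    (hF : ∀ i, MemLp (fun ω => F ω i) 2 μ) (hG : ∀ i, MemLp (fun ω => G ω i) 2 μ)
    (hG' : ∀ i, MemLp (fun ω => G' ω i) 2 μ) :
    crossCov F (fun ω => G ω - G' ω) μ = crossCov F G μ - crossCov F G' μ := by
  ext i j
  exact covariance_fun_sub_right (hF i) (hG j) (hG' j)

lemma crossCov_mulVec_right {F : Ω → Fin p → ℝ} {G : Ω → Fin q → ℝ}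
    (hF : ∀ i, MemLp (fun ω => F ω i) 2 μ) (hG : ∀ i, MemLp (fun ω => G ω i) 2 μ)
    (A : Matrix (Fin r) (Fin q) ℝ) :
    crossCov F (fun ω => A *ᵥ G ω) μ = crossCov F G μ * Aᵀ := by
  rw [← crossCov_transpose, crossCov_mulVec_left hG hF, Matrix.transpose_mul, crossCov_transpose]

end CrossCov

/-! ### Regression of a Gaussian process on a Gaussian vector -/

section GaussianConditioning

variable {Ω : Type*} [MeasurableSpace Ω] {μ : Measure Ω} {d m : ℕ} {ι : Type*}
  {X : ι → Ω → Fin d → ℝ} {U : Ω → Fin m → ℝ} {A : ι → Matrix (Fin d) (Fin m) ℝ}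

omit [MeasurableSpace Ω] in
lemma sub_mulVec_mem_span (t : ι) (i : Fin d) :
    (fun ω => (X t ω - A t *ᵥ U ω) i) ∈ Submodule.span ℝ (Set.range
      (Sum.elim (fun (p : ι × Fin d) ω => X p.1 ω p.2) fun k ω => U ω k)) := by
  have : (fun ω => (X t ω - A t *ᵥ U ω) i)
      = (fun ω => X t ω i) - ∑ k, A t i k • fun ω => U ω k := by
    ext ω; simp [Matrix.mulVec, dotProduct, Finset.sum_apply]
  rw [this]
  exact Submodule.sub_mem _ (Submodule.subset_span ⟨.inl (t, i), rfl⟩)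
    (Submodule.sum_mem _ fun k _ => Submodule.smul_mem _ _ (Submodule.subset_span ⟨.inr k, rfl⟩))

/-- The residual of the linear regression of a Gaussian process on a Gaussian vector is independent
of this vector. -/
lemma indepFun_residual
    (hG : IsGaussianProcess
      (Sum.elim (fun (p : ι × Fin d) ω => X p.1 ω p.2) fun k ω => U ω k) μ)
    (hA : ∀ t, A t * crossCov U U μ = crossCov (X t) U μ) :
    IndepFun (fun ω t => X t ω - A t *ᵥ U ω) U μ := by
  have := hG.isProbabilityMeasure
  have hXL : ∀ t i, MemLp (fun ω => X t ω i) 2 μ := fun t i =>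
    (hG.hasGaussianLaw_eval (.inl (t, i))).memLp_two
  have hUL : ∀ k, MemLp (fun ω => U ω k) 2 μ := fun k =>
    (hG.hasGaussianLaw_eval (.inr k)).memLp_two
  have hjoint : IsGaussianProcess (Sum.elim
      (fun (p : ι × Fin d) ω => (X p.1 ω - A p.1 *ᵥ U ω) p.2) fun k ω => U ω k) μ := by
    refine IsGaussianProcess.of_mem_span hG ?_
    rintro (⟨t, i⟩ | k)
    · exact sub_mulVec_mem_span t i
    · exact Submodule.subset_span ⟨.inr k, rfl⟩
  have hcov : ∀ t, crossCov (fun ω => X t ω - A t *ᵥ U ω) U μ = 0 := fun t => by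
    rw [crossCov_sub_left (hXL t) (memLp_mulVec hUL _) hUL, crossCov_mulVec_left hUL hUL, hA,
      sub_self]
  have h := IsGaussianProcess.indepFun_of_covariance_eq_zero hjoint
    (fun p => hjoint.aemeasurable (.inl p)) (fun k => hjoint.aemeasurable (.inr k))
    fun p k => congrFun (congrFun (hcov p.1) p.2) k
  exact h.comp (MeasurableEquiv.curry ι (Fin d) ℝ).measurable measurable_id

/-- The conditional law of a Gaussian process given a Gaussian vector. -/
lemma isConditionedProcess_iff_isGaussianWith (hX : ∀ t, Measurable (X t)) (hU : Measurable U)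
    (hG : IsGaussianProcess
      (Sum.elim (fun (p : ι × Fin d) ω => X p.1 ω p.2) fun k ω => U ω k) μ)
    (hC : (crossCov U U μ).PosDef) (hA : ∀ t, A t * crossCov U U μ = crossCov (X t) U μ)
    {Ω' : Type*} [MeasurableSpace Ω'] {ν : Measure Ω'} {B : ι → Ω' → Fin d → ℝ}
    {u : Fin m → ℝ} :
    IsConditionedProcess X U u μ B ν ↔ IsGaussianWith B
      (fun t => (fun i => ∫ ω, X t ω i ∂μ) + A t *ᵥ (u - fun k => ∫ ω, U ω k ∂μ))
      (fun s t => crossCov (X s) (X t) μ - A s * crossCov U (X t) μ) ν := by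
  have := hG.isProbabilityMeasure
  have hXL : ∀ t i, MemLp (fun ω => X t ω i) 2 μ := fun t i =>
    (hG.hasGaussianLaw_eval (.inl (t, i))).memLp_two
  have hUL : ∀ k, MemLp (fun ω => U ω k) 2 μ := fun k =>
    (hG.hasGaussianLaw_eval (.inr k)).memLp_two
  have hUG : HasGaussianLaw (fun ω k => U ω k) μ := by
    classical
    have h := hG.hasGaussianLaw (Finset.univ.image Sum.inr)
    let L : ((Finset.univ.image (Sum.inr : Fin m → (ι × Fin d) ⊕ Fin m) : Finset _) → ℝ)
        →L[ℝ] (Fin m → ℝ) := ContinuousLinearMap.pi fun k =>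
      ContinuousLinearMap.proj ⟨.inr k, Finset.mem_image_of_mem _ (Finset.mem_univ k)⟩
    exact h.map_fun L
  have hopen : (μ.map U).IsOpenPosMeasure :=
    HasGaussianLaw.isOpenPosMeasure_map (V := fun k ω => U ω k) hUG hC
  have hind := indepFun_residual hG hA
  have hRL : ∀ t i, MemLp (fun ω => (X t ω - A t *ᵥ U ω) i) 2 μ := fun t i =>
    (hXL t i).sub (memLp_mulVec hUL _ i)
  have hRG : IsGaussianWith (fun t ω => X t ω - A t *ᵥ U ω)
      (fun t => (fun i => ∫ ω, X t ω i ∂μ) - A t *ᵥ fun k => ∫ ω, U ω k ∂μ)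
      (fun s t => crossCov (X s) (X t) μ - A s * crossCov U (X t) μ) μ := by
    have hRm : Measurable fun ω t => X t ω - A t *ᵥ U ω := by fun_prop
    refine ⟨hRm.aemeasurable, IsGaussianProcess.of_mem_span hG fun p => sub_mulVec_mem_span p.1 p.2,
      fun t i => ?_, fun s t i j => ?_⟩
    · simp only [Pi.sub_apply]
      rw [integral_sub ((hXL t i).integrable one_le_two)
        ((memLp_mulVec hUL _ i).integrable one_le_two)]
      simp only [Matrix.mulVec, dotProduct]
      rw [integral_finsetSum _ fun k _ => ((hUL k).integrable one_le_two).const_mul _]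
      simp only [integral_const_mul]
    · have h0 : crossCov (fun ω => X s ω - A s *ᵥ U ω) U μ = 0 := by
        rw [crossCov_sub_left (hXL s) (memLp_mulVec hUL _) hUL, crossCov_mulVec_left hUL hUL, hA,
          sub_self]
      have h1 : crossCov (fun ω => X s ω - A s *ᵥ U ω) (fun ω => X t ω - A t *ᵥ U ω) μ
          = crossCov (X s) (X t) μ - A s * crossCov U (X t) μ := by
        rw [crossCov_sub_right (hRL s) (hXL t) (memLp_mulVec hUL _),
          crossCov_mulVec_right (hRL s) hUL, h0, Matrix.zero_mul, sub_zero,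
          crossCov_sub_left (hXL s) (memLp_mulVec hUL _) (hXL t),
          crossCov_mulVec_left hUL (hXL t)]
      exact congrFun (congrFun h1 i) j
  rw [isConditionedProcess_iff hX hU hind hopen,
    (hRG.add_const fun t => A t *ᵥ u).hasLaw_iff]
  have hmean : ((fun t => (fun i => ∫ ω, X t ω i ∂μ) - A t *ᵥ fun k => ∫ ω, U ω k ∂μ)
      + fun t => A t *ᵥ u) = fun t => (fun i => ∫ ω, X t ω i ∂μ)
        + A t *ᵥ (u - fun k => ∫ ω, U ω k ∂μ) := by
    ext t i
    simp only [Pi.add_apply, Pi.sub_apply, Matrix.mulVec_sub]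
    ring
  rw [hmean]

end GaussianConditioning

/-! ### Linear views of the terminal value of an Ornstein-Uhlenbeck process -/

section View

variable {d m : ℕ}

lemma posDef_add_mul_mul_transpose {F : Matrix (Fin m) (Fin d) ℝ} {V : Matrix (Fin d) (Fin d) ℝ}
    {S : Matrix (Fin m) (Fin m) ℝ} (hV : V.PosSemidef) (hS : S.PosDef) :
    (F * V * Fᵀ + S).PosDef := by
  have := hV.mul_mul_conjTranspose_same F
  rw [Matrix.conjTranspose_eq_transpose_of_trivial] at this
  exact hS.posSemidef_add this

lemma posSemidef_transpose_mul_inv_mul {F : Matrix (Fin m) (Fin d) ℝ}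
    {S : Matrix (Fin m) (Fin m) ℝ} (hS : S.PosDef) : (Fᵀ * S⁻¹ * F).PosSemidef := by
  have := hS.inv.posSemidef.conjTranspose_mul_mul_same F
  rwa [Matrix.conjTranspose_eq_transpose_of_trivial] at this

/-- Factor as `(V⁻¹ + Q) V`. The form `1 + Q V` avoids inverting `Q`, which is singular when the
view misses some directions. -/
lemma isUnit_one_add_mul {Q V : Matrix (Fin d) (Fin d) ℝ} (hQ : Q.PosSemidef) (hV : V.PosDef) :
    IsUnit (1 + Q * V) := by
  have h1 : 1 + Q * V = (V⁻¹ + Q) * V := by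
    rw [Matrix.add_mul, Matrix.nonsing_inv_mul _ ((Matrix.isUnit_iff_isUnit_det _).1 hV.isUnit)]
  rw [h1]
  exact (hV.inv.add_posSemidef hQ).isUnit.mul hV.isUnit

/-- The mean function of an Ornstein-Uhlenbeck process from `a`, when its value at time `T` is
observed with precision `Q` and precision-weighted observation `h`. -/
noncomputable def bridgeMean (Θ Sig : Matrix (Fin d) (Fin d) ℝ) (T : ℝ≥0)
    (Q : Matrix (Fin d) (Fin d) ℝ) (h a : Fin d → ℝ) (t : Set.Iic T) : Fin d → ℝ :=
  expM Θ (-(t : ℝ≥0)) *ᵥ a + (ouCov Θ Sig t T * (1 + Q * ouCov Θ Sig T T)⁻¹) *ᵥ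
    (h - Q *ᵥ (expM Θ (-T) *ᵥ a))

/-- The covariance function of an Ornstein-Uhlenbeck process, when its value at time `T` is
observed with precision `Q`. -/
noncomputable def bridgeCov (Θ Sig : Matrix (Fin d) (Fin d) ℝ) (T : ℝ≥0)
    (Q : Matrix (Fin d) (Fin d) ℝ) (s t : Set.Iic T) : Matrix (Fin d) (Fin d) ℝ :=
  ouCov Θ Sig s t - ouCov Θ Sig s T * (1 + Q * ouCov Θ Sig T T)⁻¹ * Q * ouCov Θ Sig T t

/-- With `W = (1 + Q V)⁻¹`, the relation `W (1 + Q V) = 1` reads `1 - W Q V = W`. -/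
lemma bridgeCov_right {Θ Sig : Matrix (Fin d) (Fin d) ℝ} {T : ℝ≥0} {Q : Matrix (Fin d) (Fin d) ℝ}
    (hQ : Q.PosSemidef) (hSig : Sig.PosDef) (hT : 0 < T) (s : Set.Iic T) :
    bridgeCov Θ Sig T Q s ⟨T, Set.self_mem_Iic⟩ = ouCov Θ Sig s T * (1 + Q * ouCov Θ Sig T T)⁻¹ := by
  have hu := (Matrix.isUnit_iff_isUnit_det _).1
    (isUnit_one_add_mul hQ (posDef_ouCov_self (Θ := Θ) hSig hT))
  have h1 := Matrix.nonsing_inv_mul _ hu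
  rw [Matrix.mul_add, Matrix.mul_one] at h1
  have h2 := congrArg (fun M => ouCov Θ Sig s T * M) h1
  simp only [Matrix.mul_add, Matrix.mul_one] at h2
  rw [bridgeCov, sub_eq_iff_eq_add]
  simp only [Matrix.mul_assoc] at h2 ⊢
  exact h2.symm

/-- The inverse of `V (1 + Q V)⁻¹` is `V⁻¹ + Q`. This is both the meaning of the precision gain and
the means of recovering `Q` from the conditional law. -/
lemma inv_bridgeCov {Θ Sig : Matrix (Fin d) (Fin d) ℝ} {T : ℝ≥0} {Q : Matrix (Fin d) (Fin d) ℝ}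
    (hQ : Q.PosSemidef) (hSig : Sig.PosDef) (hT : 0 < T) :
    (bridgeCov Θ Sig T Q ⟨T, Set.self_mem_Iic⟩ ⟨T, Set.self_mem_Iic⟩)⁻¹ - (ouCov Θ Sig T T)⁻¹ = Q := by
  have hV := posDef_ouCov_self (Θ := Θ) hSig hT
  have hVu := (Matrix.isUnit_iff_isUnit_det _).1 hV.isUnit
  have hu := (Matrix.isUnit_iff_isUnit_det _).1 (isUnit_one_add_mul hQ hV)
  rw [bridgeCov_right hQ hSig hT, Matrix.mul_inv_rev, Matrix.nonsing_inv_nonsing_inv _ hu,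
    Matrix.add_mul, Matrix.one_mul, Matrix.mul_assoc, Matrix.mul_nonsing_inv _ hVu,
    Matrix.mul_one, add_sub_cancel_left]

variable {Ω : Type*} [MeasurableSpace Ω] {μ : Measure Ω} {n : ℕ}
  {Θ : Matrix (Fin d) (Fin d) ℝ} {L : Matrix (Fin d) (Fin n) ℝ} {a : Fin d → ℝ} {T : ℝ≥0}
  {X : ℝ≥0 → Ω → Fin d → ℝ} {U : Ω → Fin m → ℝ}
  {F : Matrix (Fin m) (Fin d) ℝ} {S : Matrix (Fin m) (Fin m) ℝ}

/-- `U` is jointly Gaussian with `(X(t))_{t ≤ T}`, with the means and covariances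
of `F X(T) + N`, where `N` is centered with covariance `S` and independent of `(X(t))_{t ≤ T}`. -/
structure IsGaussianView (Θ : Matrix (Fin d) (Fin d) ℝ) (L : Matrix (Fin d) (Fin n) ℝ)
    (a : Fin d → ℝ) (T : ℝ≥0) (X : ℝ≥0 → Ω → Fin d → ℝ) (F : Matrix (Fin m) (Fin d) ℝ)
    (S : Matrix (Fin m) (Fin m) ℝ) (U : Ω → Fin m → ℝ) (μ : Measure Ω) : Prop where
  measurable : Measurable U
  isGaussianProcess : IsGaussianProcess (Sum.elim
    (fun (p : Set.Iic T × Fin d) ω => X p.1 ω p.2) fun k ω => U ω k) μ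
  mean : (fun k => ∫ ω, U ω k ∂μ) = F *ᵥ (expM Θ (-T) *ᵥ a)
  crossCov_left : ∀ t ≤ T, crossCov (X t) U μ = ouCov Θ (L * Lᵀ) t T * Fᵀ
  crossCov_self : crossCov U U μ = F * ouCov Θ (L * Lᵀ) T T * Fᵀ + S

/-- The weights of the regression of `X(t)` on a view. -/
noncomputable def viewWeight (Θ Sig : Matrix (Fin d) (Fin d) ℝ) (T : ℝ≥0)
    (F : Matrix (Fin m) (Fin d) ℝ) (S : Matrix (Fin m) (Fin m) ℝ) (t : Set.Iic T) :
    Matrix (Fin d) (Fin m) ℝ :=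
  ouCov Θ Sig t T * (1 + Fᵀ * S⁻¹ * F * ouCov Θ Sig T T)⁻¹ * (Fᵀ * S⁻¹)

/-- Push-through identity `Fᵀ S⁻¹ (F V Fᵀ + S) = (1 + Q V) Fᵀ`: it moves the inverse from the space
of observations to the state space, where only `Q` appears. -/
lemma IsGaussianView.viewWeight_mul (hU : IsGaussianView Θ L a T X F S U μ)
    (hL : (L * Lᵀ).PosDef) (hS : S.PosDef) (hT : 0 < T) (t : Set.Iic T) :
    viewWeight Θ (L * Lᵀ) T F S t * crossCov U U μ = crossCov (X t) U μ := by
  have hu := (Matrix.isUnit_iff_isUnit_det _).1 (isUnit_one_add_mul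
    (posSemidef_transpose_mul_inv_mul (F := F) hS) (posDef_ouCov_self (Θ := Θ) hL hT))
  have hSu := (Matrix.isUnit_iff_isUnit_det _).1 hS.isUnit
  have h1 : Fᵀ * S⁻¹ * (F * ouCov Θ (L * Lᵀ) T T * Fᵀ + S)
      = (1 + Fᵀ * S⁻¹ * F * ouCov Θ (L * Lᵀ) T T) * Fᵀ := by
    rw [Matrix.mul_add, Matrix.add_mul, Matrix.mul_assoc Fᵀ S⁻¹ S, Matrix.nonsing_inv_mul _ hSu,
      Matrix.mul_one, Matrix.one_mul, add_comm]
    simp only [Matrix.mul_assoc]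
  rw [hU.crossCov_self, hU.crossCov_left t t.2, viewWeight, Matrix.mul_assoc, h1,
    Matrix.mul_assoc, ← Matrix.mul_assoc _ _ Fᵀ, Matrix.nonsing_inv_mul _ hu, Matrix.one_mul]

lemma crossCov_ou [IsProbabilityMeasure μ] (hX : IsOU Θ L a X μ) (s t : ℝ≥0) :
    crossCov (X s) (X t) μ = ouCov Θ (L * Lᵀ) s t := by
  ext i j; exact hX.isGaussianProcess.2.2 s t i j

/-- The Ornstein-Uhlenbeck process conditioned on a view of its terminal value. -/
lemma IsGaussianView.isConditionedProcess_iff [IsProbabilityMeasure μ]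
    (hU : IsGaussianView Θ L a T X F S U μ) (hX : IsOU Θ L a X μ)
    (hL : (L * Lᵀ).PosDef) (hS : S.PosDef) (hT : 0 < T) {Ω' : Type*} [MeasurableSpace Ω']
    {ν : Measure Ω'} {B : Set.Iic T → Ω' → Fin d → ℝ} {u : Fin m → ℝ} :
    IsConditionedProcess (fun t : Set.Iic T => X t) U u μ B ν ↔
      IsGaussianWith B (bridgeMean Θ (L * Lᵀ) T (Fᵀ * S⁻¹ * F) ((Fᵀ * S⁻¹) *ᵥ u) a)
        (bridgeCov Θ (L * Lᵀ) T (Fᵀ * S⁻¹ * F)) ν := by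
  have hC : (crossCov U U μ).PosDef := by
    rw [hU.crossCov_self]
    exact posDef_add_mul_mul_transpose (posDef_ouCov_self hL hT).posSemidef hS
  rw [isConditionedProcess_iff_isGaussianWith (X := fun t : Set.Iic T => X t) (fun t => hX.measurable t) hU.measurable
    hU.isGaussianProcess hC (hU.viewWeight_mul hL hS hT)]
  have hm : (fun t : Set.Iic T => (fun i => ∫ ω, X t ω i ∂μ)
      + viewWeight Θ (L * Lᵀ) T F S t *ᵥ (u - fun k => ∫ ω, U ω k ∂μ))
      = bridgeMean Θ (L * Lᵀ) T (Fᵀ * S⁻¹ * F) ((Fᵀ * S⁻¹) *ᵥ u) a := by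
    ext1 t
    have h1 : (fun i => ∫ ω, X t ω i ∂μ) = expM Θ (-(t : ℝ≥0)) *ᵥ a :=
      funext fun i => hX.isGaussianProcess.2.1 t i
    rw [hU.mean, h1, bridgeMean, viewWeight, ← Matrix.mulVec_mulVec _ _ (Fᵀ * S⁻¹),
      Matrix.mulVec_sub (Fᵀ * S⁻¹), Matrix.mulVec_mulVec _ (Fᵀ * S⁻¹) F]
  have hc : (fun s t : Set.Iic T => crossCov (X s) (X t) μ
      - viewWeight Θ (L * Lᵀ) T F S s * crossCov U (X t) μ)
      = bridgeCov Θ (L * Lᵀ) T (Fᵀ * S⁻¹ * F) := by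
    ext1 s; ext1 t
    have hST : (L * Lᵀ)ᵀ = L * Lᵀ := by rw [Matrix.transpose_mul, Matrix.transpose_transpose]
    rw [crossCov_ou hX, ← crossCov_transpose, hU.crossCov_left t t.2, Matrix.transpose_mul,
      ouCov_transpose hST, Matrix.transpose_transpose, bridgeCov, viewWeight]
    simp only [Matrix.mul_assoc]
  rw [hm, hc]

lemma IsGaussianView.condCovMatrix_ae_eq [IsProbabilityMeasure μ]
    (hU : IsGaussianView Θ L a T X F S U μ) (hX : IsOU Θ L a X μ)
    (hL : (L * Lᵀ).PosDef) (hS : S.PosDef) (hT : 0 < T) :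
    ∀ᵐ ω ∂μ, condCovMatrix (X T) U μ ω
      = bridgeCov Θ (L * Lᵀ) T (Fᵀ * S⁻¹ * F) ⟨T, Set.self_mem_Iic⟩ ⟨T, Set.self_mem_Iic⟩ := by
  have hXL : ∀ i, MemLp (fun ω => X T ω i) 2 μ := fun i =>
    (hX.isGaussianProcess.1.hasGaussianLaw_eval (T, i)).memLp_two
  have hUL : ∀ k, MemLp (fun ω => U ω k) 2 μ := fun k =>
    (hU.isGaussianProcess.hasGaussianLaw_eval (.inr k)).memLp_two
  have hA := hU.viewWeight_mul hL hS hT ⟨T, Set.self_mem_Iic⟩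
  have hind := (indepFun_residual hU.isGaussianProcess (hU.viewWeight_mul hL hS hT)).comp
    (measurable_pi_apply (⟨T, Set.self_mem_Iic⟩ : Set.Iic T)) measurable_id
  filter_upwards [_root_.condCovMatrix_ae_eq (hX.measurable T) hU.measurable hind hXL hUL] with ω hω
  rw [hω]
  set A := viewWeight Θ (L * Lᵀ) T F S ⟨T, Set.self_mem_Iic⟩ with hAdef
  have hAUL := memLp_mulVec hUL A
  have hRL : ∀ i, MemLp (fun ω => (X T ω - A *ᵥ U ω) i) 2 μ := fun i => (hXL i).sub (hAUL i)
  have h0 : crossCov (fun ω => X T ω - A *ᵥ U ω) U μ = 0 := by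
    rw [crossCov_sub_left hXL hAUL hUL, crossCov_mulVec_left hUL hUL, hA, sub_self]
  have hST : (L * Lᵀ)ᵀ = L * Lᵀ := by rw [Matrix.transpose_mul, Matrix.transpose_transpose]
  change crossCov (fun ω => X T ω - A *ᵥ U ω) (fun ω => X T ω - A *ᵥ U ω) μ = _
  rw [crossCov_sub_right hRL hXL hAUL, crossCov_mulVec_right hRL hUL, h0, Matrix.zero_mul,
    sub_zero, crossCov_sub_left hXL hAUL hXL, crossCov_mulVec_left hUL hXL, crossCov_ou hX,
    ← crossCov_transpose (X T) U, hU.crossCov_left T le_rfl, Matrix.transpose_mul,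
    ouCov_transpose hST, Matrix.transpose_transpose, bridgeCov, hAdef, viewWeight]
  simp only [Matrix.mul_assoc]

/-- Observing the coordinates of `X` at the times `T + δ i`. -/
lemma isGaussianView_bridge [IsProbabilityMeasure μ] (hX : IsOU Θ L a X μ) (T : ℝ≥0)
    (δ : Fin d → ℝ≥0) :
    IsGaussianView Θ L a T X (bridgeF Θ δ) (bridgeC Θ (L * Lᵀ) δ)
      (fun ω i => X (T + δ i) ω i) μ where
  measurable := measurable_pi_lambda _ fun i => (measurable_pi_apply i).comp (hX.measurable _)
  isGaussianProcess := by
    have := hX.isGaussianProcess.1.comp_right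
      (Sum.elim (fun p : Set.Iic T × Fin d => ((p.1 : ℝ≥0), p.2)) fun k => (T + δ k, k))
    have h : (Sum.elim (fun (p : Set.Iic T × Fin d) ω => X p.1 ω p.2) fun k ω => X (T + δ k) ω k)
        = (fun (p : ℝ≥0 × Fin d) ω => X p.1 ω p.2) ∘
          (Sum.elim (fun p : Set.Iic T × Fin d => ((p.1 : ℝ≥0), p.2)) fun k => (T + δ k, k)) := by
      funext p
      rcases p with p | k <;> rfl
    rw [h]
    exact this
  mean := by
    ext k
    rw [hX.isGaussianProcess.2.1, NNReal.coe_add, neg_add_rev, expM_add, ← Matrix.mulVec_mulVec]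
    simp only [Matrix.mulVec, dotProduct, bridgeF_apply]
  crossCov_left t ht := by
    have hST : (L * Lᵀ)ᵀ = L * Lᵀ := by rw [Matrix.transpose_mul, Matrix.transpose_transpose]
    ext i k
    have := hX.isGaussianProcess.2.2 t (T + δ k) i k
    rw [← ouCov_transpose hST, ouCov_add_left ht, Matrix.transpose_mul, ouCov_transpose hST,
      Matrix.mul_apply] at this
    rw [Matrix.mul_apply]
    simp only [Matrix.transpose_apply, bridgeF_apply] at this ⊢
    exact this
  crossCov_self := by
    ext k l
    have := hX.isGaussianProcess.2.2 (T + δ k) (T + δ l) k l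
    -- Entry `(k, l)` involves only row `k` of `exp(-δ_k Θ)` and row `l` of `exp(-δ_l Θ)`, which are
    -- rows of `F(δ)`.
    rw [ouCov_add_add, Matrix.add_apply, ← bridgeC_apply] at this
    refine this.trans ?_
    rw [Matrix.add_apply]
    simp only [Matrix.mul_apply, Matrix.transpose_apply, bridgeF_apply]

/-- A noisy linear view of `X(T)`. -/
lemma IsNoisyView.isGaussianView [IsProbabilityMeasure μ] (hX : IsOU Θ L a X μ)
    (hU : IsNoisyView F S T X U μ) (hS : S.PosDef) : IsGaussianView Θ L a T X F S U μ := by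
  set N : Ω → Fin m → ℝ := fun ω => U ω - F *ᵥ X T ω with hN
  have hXm := hX.measurable
  have hUm := hU.measurable
  obtain ⟨hNG, hNm, hNc⟩ := hasGaussianLaw_of_map_toLp_eq (V := fun k ω => N ω k) (m := 0)
    (by fun_prop) hS.posSemidef hU.law.map_eq
  have hNproc : IsGaussianProcess (fun (k : Fin m) ω => N ω k) μ := ⟨fun I =>
    hNG.map_fun (ContinuousLinearMap.pi fun i : I => ContinuousLinearMap.proj i.1)⟩
  have hXproc : IsGaussianProcess (fun (p : Set.Iic T × Fin d) ω => X p.1 ω p.2) μ :=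
    hX.isGaussianProcess.1.comp_right fun p : Set.Iic T × Fin d => ((p.1 : ℝ≥0), p.2)
  have hind : IndepFun (fun ω (p : Set.Iic T × Fin d) => X p.1 ω p.2) N μ :=
    hU.indep.comp (φ := fun (x : ℝ≥0 → Fin d → ℝ) (p : Set.Iic T × Fin d) => x p.1 p.2)
      (by fun_prop) measurable_id
  have hjoint := isGaussianProcess_sumElim hXproc hNproc hind
  have hXL : ∀ t i, MemLp (fun ω => X t ω i) 2 μ := fun t i =>
    (hX.isGaussianProcess.1.hasGaussianLaw_eval (t, i)).memLp_two
  have hNL : ∀ k, MemLp (fun ω => N ω k) 2 μ := fun k =>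
    (hNproc.hasGaussianLaw_eval k).memLp_two
  have hFXL := memLp_mulVec (hXL T) F
  have hUN : U = fun ω => F *ᵥ X T ω + N ω := by ext ω; simp [hN]
  have hUL : ∀ k, MemLp (fun ω => U ω k) 2 μ := fun k => by
    rw [hUN]; exact (hFXL k).add (hNL k)
  have hXN : ∀ t, crossCov (X t) N μ = 0 := fun t => by
    ext i k
    refine IndepFun.covariance_eq_zero ?_ (hXL t i) (hNL k)
    exact hU.indep.comp (φ := fun (x : ℝ≥0 → Fin d → ℝ) => x t i) (ψ := fun v : Fin m → ℝ => v k)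
      (by fun_prop) (by fun_prop)
  have hST : (L * Lᵀ)ᵀ = L * Lᵀ := by rw [Matrix.transpose_mul, Matrix.transpose_transpose]
  have hXU : ∀ t, crossCov (X t) U μ = ouCov Θ (L * Lᵀ) t T * Fᵀ := fun t => by
    have h1 : crossCov (X t) N μ = crossCov (X t) U μ - crossCov (X t) (X T) μ * Fᵀ := by
      rw [hN, crossCov_sub_right (hXL t) hUL hFXL, crossCov_mulVec_right (hXL t) (hXL T)]
    rw [hXN, crossCov_ou hX] at h1
    exact (sub_eq_zero.1 h1.symm)
  refine ⟨hUm, ?_, ?_, fun t _ => hXU t, ?_⟩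
  · refine IsGaussianProcess.of_mem_span hjoint ?_
    rintro (p | k)
    · exact Submodule.subset_span ⟨.inl p, rfl⟩
    · have : (Sum.elim (fun (p : Set.Iic T × Fin d) ω => X p.1 ω p.2) (fun k ω => U ω k) (.inr k))
          = (∑ l, F k l • fun ω => X T ω l) + fun ω => N ω k := by
        ext ω
        simp [hN, Matrix.mulVec, dotProduct, Finset.sum_apply]
      rw [this]
      exact Submodule.add_mem _ (Submodule.sum_mem _ fun l _ => Submodule.smul_mem _ _
        (Submodule.subset_span ⟨.inl (⟨T, Set.self_mem_Iic⟩, l), rfl⟩))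
        (Submodule.subset_span ⟨.inr k, rfl⟩)
  · ext k
    have h1 : ∫ ω, N ω k ∂μ = 0 := hNm k
    simp only [hN, Pi.sub_apply] at h1
    rw [integral_sub ((hUL k).integrable one_le_two) ((hFXL k).integrable one_le_two),
      sub_eq_zero] at h1
    rw [h1]
    simp only [Matrix.mulVec, dotProduct]
    rw [integral_finsetSum _ fun l _ => ((hXL T l).integrable one_le_two).const_mul _]
    simp only [integral_const_mul, hX.isGaussianProcess.2.1]
    rfl
  · have h1 : crossCov N N μ = S := by
      ext k l; exact hNc k l
    have h2 : crossCov N (fun ω => F *ᵥ X T ω) μ = 0 := by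
      rw [crossCov_mulVec_right hNL (hXL T), ← crossCov_transpose, hXN]; simp
    have h3 : crossCov N N μ = crossCov N U μ := by
      conv_lhs => rw [hN]
      rw [crossCov_sub_right hNL hUL hFXL, h2, sub_zero]
    have h4 : crossCov N U μ = crossCov U U μ - F * crossCov (X T) U μ := by
      rw [hN, crossCov_sub_left hUL hFXL hUL, crossCov_mulVec_left (hXL T) hUL]
    rw [h1] at h3
    rw [← h3, hXU] at h4
    rw [h4, Matrix.mul_assoc]
    abel

end View

/-! ### Multidimensional mean-reverting bridges -/

section Bridge

variable {d n : ℕ} {Θ : Matrix (Fin d) (Fin d) ℝ} {L : Matrix (Fin d) (Fin n) ℝ}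
  {a : Fin d → ℝ} {T : ℝ≥0}

/-- A coordinate conditioned on its own value at a time `S i` is deterministic at this time. -/
lemma covariance_eq_zero_of_hittingTime_le {Ω : Type*} [MeasurableSpace Ω] {μ : Measure Ω}
    [IsProbabilityMeasure μ] {X : ℝ≥0 → Ω → Fin d → ℝ} (hX : IsOU Θ L a X μ)
    (hL : (L * Lᵀ).PosDef) {S : Fin d → ℝ≥0} (hS : ∀ i, 0 < S i) {Ω' : Type*}
    [MeasurableSpace Ω'] {ν : Measure Ω'} {B : Set.Iic T → Ω' → Fin d → ℝ} {z : Fin d → ℝ}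
    (hB : IsConditionedProcess (fun t : Set.Iic T => X t) (fun ω i => X (S i) ω i) z μ B ν)
    {i : Fin d} (hi : S i ≤ T) (t : Set.Iic T) (j : Fin d) :
    cov[fun ω => B ⟨S i, hi⟩ ω i, fun ω => B t ω j; ν] = 0 := by
  set U : Ω → Fin d → ℝ := fun ω i => X (S i) ω i with hU
  have hC : crossCov U U μ = bridgeC Θ (L * Lᵀ) S := by
    ext k l
    rw [bridgeC_apply]
    exact hX.isGaussianProcess.2.2 (S k) (S l) k l
  have hpos : (crossCov U U μ).PosDef := hC ▸ posDef_bridgeC hL hS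
  have hu := (Matrix.isUnit_iff_isUnit_det _).1 hpos.isUnit
  have hG : IsGaussianProcess (Sum.elim (fun (p : Set.Iic T × Fin d) ω => X p.1 ω p.2)
      fun k ω => U ω k) μ := by
    have h : (Sum.elim (fun (p : Set.Iic T × Fin d) ω => X p.1 ω p.2) fun k ω => U ω k)
        = (fun (p : ℝ≥0 × Fin d) ω => X p.1 ω p.2) ∘
          (Sum.elim (fun p : Set.Iic T × Fin d => ((p.1 : ℝ≥0), p.2)) fun k => (S k, k)) := by
      funext p
      rcases p with p | k <;> rfl
    rw [h]
    exact hX.isGaussianProcess.1.comp_right _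
  have hUm : Measurable U :=
    measurable_pi_lambda _ fun i => (measurable_pi_apply i).comp (hX.measurable _)
  have hB' := ((isConditionedProcess_iff_isGaussianWith (X := fun t : Set.Iic T => X t)
    (A := fun t : Set.Iic T => crossCov (X t) U μ * (crossCov U U μ)⁻¹)
    (fun t => hX.measurable t) hUm hG hpos fun t => by
      rw [Matrix.mul_assoc, Matrix.nonsing_inv_mul _ hu, Matrix.mul_one]).1 hB).cov
      ⟨S i, hi⟩ t i j
  rw [hB']
  -- Coordinate `i` of `X (S i)` is coordinate `i` of `U`, so it is regressed on itself and its
  -- weights form the `i`-th row of the identity.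
  have hrow : ∀ k, (crossCov (X (S i)) U μ * (crossCov U U μ)⁻¹) i k
      = (1 : Matrix (Fin d) (Fin d) ℝ) i k := by
    intro k
    rw [← Matrix.mul_nonsing_inv _ hu, Matrix.mul_apply, Matrix.mul_apply]
    rfl
  rw [Matrix.sub_apply, Matrix.mul_apply]
  simp only [hrow]
  rw [← Matrix.mul_apply, Matrix.one_mul]
  exact sub_self _

lemma posSemidef_precisionGain (hL : (L * Lᵀ).PosDef) {δ : Fin d → ℝ≥0} (hδ : ∀ i, 0 < δ i) :
    (precisionGain Θ (L * Lᵀ) δ).PosSemidef :=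
  posSemidef_transpose_mul_inv_mul (posDef_bridgeC hL hδ)

/-- A bridge may come from any probability space, but its law depends only on the parameters.
Conversely, the given `X` shifted by `exp(-t Θ) (a' - a)` serves as a process started at `a'`. -/
lemma isMMrB_iff {Ω : Type u} [MeasurableSpace Ω] {μ : Measure Ω} [IsProbabilityMeasure μ]
    {X : ℝ≥0 → Ω → Fin d → ℝ} (hX : IsOU Θ L a X μ) (hL : (L * Lᵀ).PosDef) (hT : 0 < T)
    {δ : Fin d → ℝ≥0} (hδ : ∀ i, 0 < δ i) {Ω' : Type v} [MeasurableSpace Ω'] {ν : Measure Ω'}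
    {B : Set.Iic T → Ω' → Fin d → ℝ} {a' z : Fin d → ℝ} :
    IsMMrB.{u} Θ L a' z (fun i => T + δ i) B ν ↔
      IsGaussianWith B (bridgeMean Θ (L * Lᵀ) T (precisionGain Θ (L * Lᵀ) δ)
        (((bridgeF Θ δ)ᵀ * (bridgeC Θ (L * Lᵀ) δ)⁻¹) *ᵥ z) a')
        (bridgeCov Θ (L * Lᵀ) T (precisionGain Θ (L * Lᵀ) δ)) ν := by
  refine ⟨fun ⟨_, Ω₁, _, μ₁, X₁, _, hX₁, hB⟩ => ?_, fun hB => ⟨fun i => by positivity, Ω,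
    inferInstance, μ, fun t ω => X t ω + expM Θ (-t) *ᵥ (a' - a), inferInstance, ?_, ?_⟩⟩
  · exact ((isGaussianView_bridge hX₁ T δ).isConditionedProcess_iff hX₁ hL
      (posDef_bridgeC hL hδ) hT).1 hB
  · simpa using hX.add_expM (a' - a)
  · have hX' : IsOU Θ L a' (fun t ω => X t ω + expM Θ (-t) *ᵥ (a' - a)) μ := by
      simpa using hX.add_expM (a' - a)
    exact ((isGaussianView_bridge hX' T δ).isConditionedProcess_iff hX' hL
      (posDef_bridgeC hL hδ) hT).2 hB

lemma IsGaussianWith.precision_eq {Ω' : Type*} [MeasurableSpace Ω'] {ν : Measure Ω'}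
    {B : Set.Iic T → Ω' → Fin d → ℝ} {Sig Q Q' : Matrix (Fin d) (Fin d) ℝ}
    {m m' : Set.Iic T → Fin d → ℝ} (h : IsGaussianWith B m (bridgeCov Θ Sig T Q) ν)
    (h' : IsGaussianWith B m' (bridgeCov Θ Sig T Q') ν) (hQ : Q.PosSemidef) (hQ' : Q'.PosSemidef)
    (hSig : Sig.PosDef) (hT : 0 < T) : Q = Q' := by
  rw [← inv_bridgeCov (Θ := Θ) hQ hSig hT, ← inv_bridgeCov (Θ := Θ) hQ' hSig hT]
  congr 2
  ext i j
  rw [← h.cov, h'.cov]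

/-- The noisy view of the terminal value leaves no coordinate deterministic at a positive time. -/
lemma not_deterministic {Ω' : Type*} [MeasurableSpace Ω'] {ν : Measure Ω'}
    {B : Set.Iic T → Ω' → Fin d → ℝ} {Sig Q : Matrix (Fin d) (Fin d) ℝ}
    {m : Set.Iic T → Fin d → ℝ} (h : IsGaussianWith B m (bridgeCov Θ Sig T Q) ν)
    (hQ : Q.PosSemidef) (hSig : Sig.PosDef) (hT : 0 < T) {s : ℝ≥0} (hs : 0 < s) (hsT : s ≤ T)
    (i : Fin d) : ∃ t j, cov[fun ω => B ⟨s, hsT⟩ ω i, fun ω => B t ω j; ν] ≠ 0 := by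
  by_contra! h0
  -- It suffices to test against `t = T`: an invertible matrix has no zero row.
  have hu : IsUnit (bridgeCov Θ Sig T Q ⟨s, hsT⟩ ⟨T, Set.self_mem_Iic⟩) := by
    rw [bridgeCov_right hQ hSig hT]
    refine (isUnit_ouCov hSig hs hsT).mul ?_
    rw [Matrix.isUnit_nonsing_inv_iff]
    exact isUnit_one_add_mul hQ (posDef_ouCov_self hSig hT)
  obtain ⟨R, hR⟩ := hu.exists_right_inv
  have := congrFun (congrFun hR i) i
  rw [Matrix.mul_apply, Matrix.one_apply_eq] at this
  simp only [← h.cov, h0, zero_mul, Finset.sum_const_zero] at this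
  exact zero_ne_one this

/-- At time `T` the vector `h` enters through an invertible matrix. This makes the target unique. -/
lemma bridgeMean_injective {Sig Q : Matrix (Fin d) (Fin d) ℝ} {h h' : Fin d → ℝ}
    (hQ : Q.PosSemidef) (hSig : Sig.PosDef) (hT : 0 < T)
    (he : bridgeMean Θ Sig T Q h a = bridgeMean Θ Sig T Q h' a) : h = h' := by
  have h1 := congrFun he ⟨T, Set.self_mem_Iic⟩
  have hu : IsUnit (ouCov Θ Sig T T * (1 + Q * ouCov Θ Sig T T)⁻¹) := by
    refine (isUnit_ouCov hSig hT le_rfl).mul ?_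
    rw [Matrix.isUnit_nonsing_inv_iff]
    exact isUnit_one_add_mul hQ (posDef_ouCov_self hSig hT)
  rw [bridgeMean, bridgeMean, add_right_inj] at h1
  exact sub_left_injective (Matrix.mulVec_injective_of_isUnit hu h1)

/-- The range of `Pᵀ Ω⁻¹` is that of `Pᵀ Ω⁻¹ P`. -/
lemma exists_mulVec_eq {K : ℕ} (P : Matrix (Fin K) (Fin d) ℝ) {Om : Matrix (Fin K) (Fin K) ℝ}
    (hOm : Om.PosDef) (y : Fin K → ℝ) :
    ∃ x, (Pᵀ * Om⁻¹ * P) *ᵥ x = (Pᵀ * Om⁻¹) *ᵥ y := by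
  have hker : ∀ x, (Pᵀ * Om⁻¹ * P) *ᵥ x = 0 ↔ P *ᵥ x = 0 := by
    intro x
    refine ⟨fun h => ?_, fun h => by rw [← Matrix.mulVec_mulVec, h, Matrix.mulVec_zero]⟩
    by_contra hne
    have hp := hOm.inv.dotProduct_mulVec_pos hne
    have : x ⬝ᵥ (Pᵀ * Om⁻¹ * P) *ᵥ x = star (P *ᵥ x) ⬝ᵥ Om⁻¹ *ᵥ (P *ᵥ x) := by
      rw [star_trivial, Matrix.mul_assoc, ← Matrix.mulVec_mulVec, Matrix.dotProduct_mulVec,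
        Matrix.vecMul_transpose, ← Matrix.mulVec_mulVec]
    rw [← this, h, dotProduct_zero] at hp
    exact lt_irrefl _ hp
  -- Equal kernels give equal ranks, so the inclusion of ranges is an equality.
  have hrank : (Pᵀ * Om⁻¹ * P).rank = Pᵀ.rank := by
    have hk : LinearMap.ker (Pᵀ * Om⁻¹ * P).mulVecLin = LinearMap.ker P.mulVecLin := by
      ext x
      simp only [LinearMap.mem_ker, Matrix.mulVecLin_apply]
      exact hker x
    have h1 := LinearMap.finrank_range_add_finrank_ker (Pᵀ * Om⁻¹ * P).mulVecLin
    have h2 := LinearMap.finrank_range_add_finrank_ker P.mulVecLin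
    rw [hk] at h1
    rw [Matrix.rank_transpose]
    unfold Matrix.rank
    omega
  have hle : LinearMap.range (Pᵀ * Om⁻¹ * P).mulVecLin ≤ LinearMap.range Pᵀ.mulVecLin := by
    rintro _ ⟨x, rfl⟩
    refine ⟨(Om⁻¹ * P) *ᵥ x, ?_⟩
    simp only [Matrix.mulVecLin_apply, Matrix.mulVec_mulVec, Matrix.mul_assoc]
  have heq := Submodule.eq_of_le_of_finrank_eq hle hrank
  have hmem : (Pᵀ * Om⁻¹) *ᵥ y ∈ LinearMap.range Pᵀ.mulVecLin :=
    ⟨Om⁻¹ *ᵥ y, by rw [Matrix.mulVecLin_apply, Matrix.mulVec_mulVec]⟩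
  rw [← heq] at hmem
  exact hmem

end Bridge

/-! ### The alignment theorem for noisy views and bridges -/

theorem mainTheorem3 {Ω : Type u} [MeasurableSpace Ω] {Ω' : Type v} [MeasurableSpace Ω']
    {d n K : ℕ}
    (Θ : Matrix (Fin d) (Fin d) ℝ) (hΘ : ∀ z ∈ spectrum ℂ (Θ.map Complex.ofReal), 0 < z.re)
    (L : Matrix (Fin d) (Fin n) ℝ) (hL : (L * Lᵀ).PosDef)
    (a : Fin d → ℝ) (T : ℝ≥0) (hT : 0 < T)
    (P : Matrix (Fin K) (Fin d) ℝ) (Om : Matrix (Fin K) (Fin K) ℝ) (hOm : Om.PosDef)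
    (μ : Measure Ω) [IsProbabilityMeasure μ]
    (X : ℝ≥0 → Ω → Fin d → ℝ) (hX : IsOU Θ L a X μ)
    (Y : Ω → Fin K → ℝ) (hY : IsNoisyView P Om T X Y μ)
    (y : Fin K → ℝ)
    (ν : Measure Ω') [IsProbabilityMeasure ν] (B : Set.Iic T → Ω' → Fin d → ℝ)
    (hB : IsConditionedProcess (fun t : Set.Iic T => X t) Y y μ B ν) :
    -- `𝒫(δ)` is the gain in precision of `X(T)` from observing `(X₁(T + δ₁), …, X_d(T + δ_d))`
    (∀ δ : Fin d → ℝ≥0, (∀ i, 0 < δ i) → ∀ᵐ ω ∂μ,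
      (condCovMatrix (X T) (fun ω' i => X (T + δ i) ω' i) μ ω)⁻¹ -
        (condCovMatrix (X T) (X 0) μ ω)⁻¹ = precisionGain Θ (L * Lᵀ) δ) ∧
    -- characterization of the conditional processes that are bridges
    ((∃ (a' z : Fin d → ℝ) (S : Fin d → ℝ≥0), IsMMrB.{u} Θ L a' z S B ν) ↔
      ∃ δ : Fin d → ℝ≥0, (∀ i, 0 < δ i) ∧ Pᵀ * Om⁻¹ * P = precisionGain Θ (L * Lᵀ) δ) ∧
    -- consequences of the alignment condition
    (∀ δ : Fin d → ℝ≥0, (∀ i, 0 < δ i) → Pᵀ * Om⁻¹ * P = precisionGain Θ (L * Lᵀ) δ →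
      IsMMrB.{u} Θ L 0 0 (fun i => T + δ i) (fun t ω => B t ω - ∫ ω', B t ω' ∂ν) ν ∧
      (P.rank = d →
        IsUnit (bridgeF Θ δ).det ∧
        ∀ z : Fin d → ℝ, IsMMrB.{u} Θ L a z (fun i => T + δ i) B ν ↔
          z = (bridgeC Θ (L * Lᵀ) δ * ((bridgeF Θ δ)ᵀ)⁻¹ * Pᵀ * Om⁻¹) *ᵥ y)) := by
  have hQ := posSemidef_transpose_mul_inv_mul (F := P) hOm
  have hBG := ((hY.isGaussianView hX hOm).isConditionedProcess_iff hX hL hOm hT).1 hB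
  refine ⟨fun δ hδ => ?_, ⟨?_, ?_⟩, fun δ hδ hPδ => ⟨?_, fun hrank => ?_⟩⟩
  · have h0 : ∀ᵐ ω ∂μ, condCovMatrix (X T) (X 0) μ ω = ouCov Θ (L * Lᵀ) T T := by
      have hXL : ∀ t i, MemLp (fun ω => X t ω i) 2 μ := fun t i =>
        (hX.isGaussianProcess.1.hasGaussianLaw_eval (t, i)).memLp_two
      -- `X 0` is almost surely constant, hence independent of everything; the regression weight is
      -- zero and conditioning changes nothing.
      have hind : IndepFun (fun ω => X T ω - (0 : Matrix (Fin d) (Fin d) ℝ) *ᵥ X 0 ω) (X 0) μ :=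
        (indepFun_const_right _ a).congr (ae_eq_refl _)
          (by filter_upwards [hX.ae_zero_eq] with ω hω using hω.symm)
      filter_upwards [condCovMatrix_ae_eq (hX.measurable T) (hX.measurable 0) hind (hXL T) (hXL 0)]
        with ω hω
      rw [hω, ← crossCov_ou hX]
      simp [crossCov]
    filter_upwards [h0, (isGaussianView_bridge hX T δ).condCovMatrix_ae_eq hX hL
      (posDef_bridgeC hL hδ) hT] with ω h1 h2
    rw [h1, h2]
    exact inv_bridgeCov (posSemidef_precisionGain hL hδ) hL hT
  · rintro ⟨a', z, S, hMB⟩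
    obtain ⟨hS, Ω₁, _, μ₁, X₁, _, hX₁, hB₁⟩ := id hMB
    -- A hitting time at or before `T` would make a coordinate of `B` deterministic at a positive
    -- time.
    have hST : ∀ i, T < S i := by
      intro i
      by_contra! hi
      obtain ⟨t, j, hne⟩ := not_deterministic hBG hQ hL hT (hS i) hi i
      exact hne (covariance_eq_zero_of_hittingTime_le hX₁ hL hS hB₁ hi t j)
    have hS' : S = fun i => T + (S i - T) := funext fun i => (add_tsub_cancel_of_le (hST i).le).symm
    have hδ : ∀ i, 0 < S i - T := fun i => tsub_pos_of_lt (hST i)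
    rw [hS'] at hMB
    exact ⟨fun i => S i - T, hδ, hBG.precision_eq ((isMMrB_iff hX hL hT hδ).1 hMB) hQ
      (posSemidef_precisionGain hL hδ) hL hT⟩
  · rintro ⟨δ, hδ, hPδ⟩
    obtain ⟨x, hx⟩ := exists_mulVec_eq P hOm y
    -- For this target the bridge has `h = 𝒫(δ) x = Pᵀ Ω⁻¹ P x = Pᵀ Ω⁻¹ y`, the same vector as the
    -- noisy view.
    refine ⟨a, bridgeF Θ δ *ᵥ x, fun i => T + δ i, (isMMrB_iff hX hL hT hδ).2 ?_⟩
    rw [Matrix.mulVec_mulVec, ← hPδ]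
    have : (bridgeF Θ δ)ᵀ * (bridgeC Θ (L * Lᵀ) δ)⁻¹ * bridgeF Θ δ = Pᵀ * Om⁻¹ * P := hPδ.symm
    rw [this, hx]
    exact hBG
  · rw [isMMrB_iff hX hL hT hδ, ← hPδ]
    have h1 := hBG.add_const fun t => -∫ ω', B t ω' ∂ν
    -- Subtracting the mean leaves the zero function, which is `bridgeMean` with zero start and zero
    -- observation; the covariance depends on neither.
    have h2 : bridgeMean Θ (L * Lᵀ) T (Pᵀ * Om⁻¹ * P) ((Pᵀ * Om⁻¹) *ᵥ y) a
        + (fun t => -∫ ω', B t ω' ∂ν) = bridgeMean Θ (L * Lᵀ) T (Pᵀ * Om⁻¹ * P)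
        (((bridgeF Θ δ)ᵀ * (bridgeC Θ (L * Lᵀ) δ)⁻¹) *ᵥ 0) 0 := by
      ext t i
      rw [Pi.add_apply, Pi.add_apply, Pi.neg_apply, eval_integral fun j => hBG.integrable t j,
        hBG.mean]
      simp [bridgeMean]
    rw [h2] at h1
    simpa only [sub_eq_add_neg] using h1
  · have hF : IsUnit (bridgeF Θ δ) := by
      have hinj : Function.Injective P.mulVec := by
        have h1 := LinearMap.finrank_range_add_finrank_ker P.mulVecLin
        have h2 : Module.finrank ℝ (LinearMap.range P.mulVecLin) = d := hrank
        rw [h2, Module.finrank_fin_fun, Nat.add_eq_left, Submodule.finrank_eq_zero] at h1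
        exact LinearMap.ker_eq_bot.1 h1
      -- An injective `P` makes the precision positive definite; since it equals a product of square
      -- matrices ending in `F(δ)`, that factor is invertible.
      have hQpd : (Pᵀ * Om⁻¹ * P).PosDef := by
        have := hOm.inv.conjTranspose_mul_mul_same hinj
        rwa [Matrix.conjTranspose_eq_transpose_of_trivial] at this
      have h1 := hQpd.isUnit
      rw [hPδ] at h1
      exact isUnit_of_mul_isUnit_right h1
    have hFd := (Matrix.isUnit_iff_isUnit_det _).1 hF
    refine ⟨hFd, fun z => ?_⟩
    have hFT : IsUnit (bridgeF Θ δ)ᵀ.det := by rwa [Matrix.det_transpose]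
    have hCd := (Matrix.isUnit_iff_isUnit_det _).1 (posDef_bridgeC (Θ := Θ) hL hδ).isUnit
    have hz : z = (bridgeC Θ (L * Lᵀ) δ * ((bridgeF Θ δ)ᵀ)⁻¹ * Pᵀ * Om⁻¹) *ᵥ y ↔
        ((bridgeF Θ δ)ᵀ * (bridgeC Θ (L * Lᵀ) δ)⁻¹) *ᵥ z = (Pᵀ * Om⁻¹) *ᵥ y := by
      have h1 : bridgeC Θ (L * Lᵀ) δ * ((bridgeF Θ δ)ᵀ)⁻¹ * ((bridgeF Θ δ)ᵀ
          * (bridgeC Θ (L * Lᵀ) δ)⁻¹) = 1 := by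
        rw [Matrix.mul_assoc, Matrix.nonsing_inv_mul_cancel_left _ _ hFT,
          Matrix.mul_nonsing_inv _ hCd]
      have h2 := mul_eq_one_comm.1 h1
      constructor
      · rintro rfl
        rw [Matrix.mulVec_mulVec, Matrix.mul_assoc _ Pᵀ, ← Matrix.mul_assoc, h2, Matrix.one_mul]
      · intro h
        rw [Matrix.mul_assoc _ Pᵀ, ← Matrix.mulVec_mulVec, ← h, Matrix.mulVec_mulVec, h1,
          Matrix.one_mulVec]
    rw [isMMrB_iff hX hL hT hδ, hz, ← hPδ]
    refine ⟨fun h => ?_, fun h => by rw [h]; exact hBG⟩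
    -- Both descriptions of `B` give its mean function, so the two vectors `h` coincide.
    refine bridgeMean_injective (Θ := Θ) (a := a) hQ hL hT (T := T) ?_
    ext t i
    rw [← h.mean, hBG.mean]
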